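/- **Bit-length.** Let $X$ be a finite set of generators. The bit-length of a word over $X$ is the least number of symbols in an expression for it, in which every generator is a single symbol and (possibly nested) integer exponents are written in binary. The bit-length of a presentation is the number of its generators plus the sum of the bit-lengths of its relators, where a relation $u=v$ stands for the relator $uv^{-1}$. Write $x^y=y^{-1}xy$. **Groups.** For a prime $p$ let $$\mathrm{AGL}(1,p)=\{x\mapsto \alpha x+\beta:\alpha\in\mathbb F_p^*,\ \beta\in\mathbb F_p\},\qquad \mathrm{AGL}(1,p)^{(2)}=\{x\mapsto \alpha x+\beta:\alpha\in\mathbb F_p^{*2},\ \beta\in\mathbb F_p\},$$ groups of permutations of $\mathbb F_p$, where $\mathbb F_p^{*2}$ is the group of nonzero squares. **Theorem.** Consider one of the following two cases. * (Alternating case) $p\equiv 11 \pmod{12}$ is prime, $G=A_{p+2}$, $T=\mathrm{AGL}(1,p)^{(2)}$, $\kappa=(p-1)/2$, and $r,s$ are integers with $\langle r\rangle=\mathbb F_p^{*2}$ and $s(r-1)\equiv-1\pmod p$. Put $b=g^3$, $z=g^\kappa$ and $h=(b\,z^a z^{a^{-1}})^{(p+1)/2}$. * (Symmetric case) $p\equiv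 2\pmod 3$ is an odd prime, $G=S_{p+2}$, $T=\mathrm{AGL}(1,p)$, $\kappa=p-1$, and $r,s$ are integers with $\langle r\rangle=\mathbb F_p^{*}$ and $s(r-1)\equiv-1\pmod p$. Put $b=g^3$, $z=g^\kappa$ and $h=(b^2z^a z^{a^{r}})^{(p+1)/2}$. In each case such $r,s$ exist, and may be chosen in $\{0,\dots,p-1\}$. Let $\hat G$ be the group of those elements of $S_{p+2}\times T$ that induce an even permutation of the $2p+2$ points of the disjoint union $\{1,\dots,p+2\}\sqcup\mathbb F_p$. Then $\hat G$ has index two in $S_{p+2}\times T$ and is the only subgroup of index two which induces a subgroup of $A_{2p+2}$; in the alternating case $\hat G=A_{p+2}\times T$. For all $r,s$ as above, $$J=\langle a,g\mid a^p=b^\kappa,\ (a^s)^b=a^{s-1},\ (zz^a)^2=1,\ h=1\rangle\cong G,$$ $$\hat J=\langle a,g\mid a^p=b^\kappa,\ (a^s)^b=a^{s-1},\ (zz^a)^2=1\rangle\cong\hat G.$$ Moreover there is an absolute constant $C$ such that, in both cases, whenever $|r|,|s|\le p$ the bit-lengths of the above 2-generator 4-relator presentation of $G$ and of the above 2-generator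 3-relator presentation of $\hat G$ are at most $C\log p$. -/

import Mathlib

/-! ### Bit-length of words and presentations -/

/-- Expressions over an alphabet `X`, in which integer exponents may be used (and nested). -/
inductive PowExpr (X : Type) : Type
  | one : PowExpr X
  | gen : X → PowExpr X
  | mul : PowExpr X → PowExpr X → PowExpr X
  | pow : PowExpr X → ℤ → PowExpr X

namespace PowExpr

/-- The element of the free group on `X` denoted by an expression. -/
def eval {X : Type} : PowExpr X → FreeGroup X
  | one => 1
  | gen x => FreeGroup.of x
  | mul e f => e.eval * f.eval
  | pow e n => e.eval ^ n

/-- The number of symbols of an expression: every generator is a single symbol, a product is a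
concatenation, and a power `(e)^n` consists of two parentheses, the symbols of `e`, and the
exponent `n`, written in binary with a sign symbol. -/
def size {X : Type} : PowExpr X → ℕ
  | one => 1
  | gen _ => 1
  | mul e f => e.size + f.size
  | pow e n => e.size + 2 + (1 + max 1 (Nat.size n.natAbs))

end PowExpr

/-- The bit-length of a word: the least number of symbols of an expression denoting it. -/
noncomputable def wordBitLength {X : Type} (w : FreeGroup X) : ℕ :=
  sInf {k | ∃ e : PowExpr X, e.eval = w ∧ e.size = k}

/-- A group presentation with `n` generators and `m` relators. -/
structure FinPresentation (n m : ℕ) where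
  /-- the relators -/
  rel : Fin m → FreeGroup (Fin n)

namespace FinPresentation

/-- The group defined by a presentation. -/
abbrev toGroup {n m : ℕ} (P : FinPresentation n m) : Type :=
  PresentedGroup (Set.range P.rel)

/-- The bit-length of a presentation: the number of generators plus the sum of the bit-lengths
of the relators. -/
noncomputable def bitLength {n m : ℕ} (P : FinPresentation n m) : ℕ :=
  n + ∑ i, wordBitLength (P.rel i)

end FinPresentation

/-! ### The one-dimensional affine groups -/

/-- The permutations `x ↦ α x + β` of `ZMod p` with `α` in the subgroup `H` of the unit group. -/
def affineSubgroup (p : ℕ) (H : Subgroup (ZMod p)ˣ) : Subgroup (Equiv.Perm (ZMod p)) where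
  carrier := {σ | ∃ α ∈ H, ∃ β : ZMod p, ∀ x, σ x = (α : ZMod p) * x + β}
  one_mem' := ⟨1, H.one_mem, 0, fun x => by simp⟩
  mul_mem' := by
    rintro σ τ ⟨α, hα, β, hσ⟩ ⟨γ, hγ, δ, hτ⟩
    refine ⟨α * γ, H.mul_mem hα hγ, α * δ + β, fun x => ?_⟩
    rw [Equiv.Perm.mul_apply, hτ, hσ, Units.val_mul]
    ring
  inv_mem' := by
    rintro σ ⟨α, hα, β, hσ⟩
    refine ⟨α⁻¹, H.inv_mem hα, -((α⁻¹ : (ZMod p)ˣ) : ZMod p) * β, fun x => ?_⟩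
    rw [Equiv.Perm.inv_eq_iff_eq, hσ]
    have h : (α : ZMod p) * ((α⁻¹ : (ZMod p)ˣ) : ZMod p) = 1 := α.mul_inv
    linear_combination (β - x) * h

/-- The subgroup of squares in the unit group of `ZMod p`. -/
def unitSquares (p : ℕ) : Subgroup (ZMod p)ˣ := (powMonoidHom 2 : (ZMod p)ˣ →* (ZMod p)ˣ).range

/-- `AGL(1,p)`, as a group of permutations of `ZMod p`. -/
def AGL1 (p : ℕ) : Subgroup (Equiv.Perm (ZMod p)) := affineSubgroup p ⊤

/-- `AGL(1,p)^(2)`: the maps `x ↦ α x + β` where `α` is a nonzero square. -/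
def AGL1Sq (p : ℕ) : Subgroup (Equiv.Perm (ZMod p)) := affineSubgroup p (unitSquares p)

/-! ### The subgroup of `S_{p+2} × T` of elements acting evenly on the disjoint union -/

/-- The action of `S_{p+2} × T` on the disjoint union of `p + 2` points and `ZMod p`. -/
def disjointAction (p : ℕ) (T : Subgroup (Equiv.Perm (ZMod p))) :
    Equiv.Perm (Fin (p + 2)) × T →* Equiv.Perm (Fin (p + 2) ⊕ ZMod p) :=
  (Equiv.Perm.sumCongrHom (Fin (p + 2)) (ZMod p)).comp
    (MonoidHom.prodMap (MonoidHom.id _) T.subtype)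

/-- The elements of `S_{p+2} × T` that induce an even permutation of the `2p + 2` points. -/
def evenSubgroup (p : ℕ) [Fact p.Prime] (T : Subgroup (Equiv.Perm (ZMod p))) :
    Subgroup (Equiv.Perm (Fin (p + 2)) × T) :=
  (alternatingGroup (Fin (p + 2) ⊕ ZMod p)).comap (disjointAction p T)

/-! ### The presentations -/

/-- `x` conjugated by `y`, that is `x^y = y⁻¹ x y`. -/
def conjBy {G : Type*} [Group G] (x y : G) : G := y⁻¹ * x * y

/-- The generator `a`. -/
def genA : FreeGroup (Fin 2) := FreeGroup.of 0

/-- The generator `g`. -/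
def genG : FreeGroup (Fin 2) := FreeGroup.of 1

/-- The word `b = g^3`. -/
def wordB : FreeGroup (Fin 2) := genG ^ 3

/-- The word `z = g^κ`. -/
def wordZ (κ : ℕ) : FreeGroup (Fin 2) := genG ^ κ

/-- The relator of the relation `a^p = b^κ`. -/
def relPower (p κ : ℕ) : FreeGroup (Fin 2) := genA ^ p * (wordB ^ κ)⁻¹

/-- The relator of the relation `(a^s)^b = a^(s-1)`. -/
def relConj (s : ℤ) : FreeGroup (Fin 2) := conjBy (genA ^ s) wordB * (genA ^ (s - 1))⁻¹

/-- The relator `(z z^a)^2`. -/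
def relZ (κ : ℕ) : FreeGroup (Fin 2) := (wordZ κ * conjBy (wordZ κ) genA) ^ 2

/-- `⟨a, g | a^p = b^κ, (a^s)^b = a^(s-1), (z z^a)^2 = 1⟩`. -/
def presJHat (p κ : ℕ) (s : ℤ) : FinPresentation 2 3 :=
  ⟨![relPower p κ, relConj s, relZ κ]⟩

/-- `⟨a, g | a^p = b^κ, (a^s)^b = a^(s-1), (z z^a)^2 = 1, h = 1⟩`. -/
def presJ (p κ : ℕ) (s : ℤ) (h : FreeGroup (Fin 2)) : FinPresentation 2 4 :=
  ⟨![relPower p κ, relConj s, relZ κ, h]⟩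

/-- The word `(b z^a z^(a⁻¹))^((p+1)/2)`. -/
def hAlt (p κ : ℕ) : FreeGroup (Fin 2) :=
  (wordB * conjBy (wordZ κ) genA * conjBy (wordZ κ) genA⁻¹) ^ ((p + 1) / 2)

/-- The word `(b^2 z^a z^(a^r))^((p+1)/2)`. -/
def hSym (p κ : ℕ) (r : ℤ) : FreeGroup (Fin 2) :=
  (wordB ^ 2 * conjBy (wordZ κ) genA * conjBy (wordZ κ) (genA ^ r)) ^ ((p + 1) / 2)

/-- The residue class of `r` is a unit that generates the subgroup `H` of the unit group of
`ZMod p`, and `s (r - 1) ≡ -1` modulo `p`. -/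
def IsParam (p : ℕ) (H : Subgroup (ZMod p)ˣ) (r s : ℤ) : Prop :=
  (∃ u : (ZMod p)ˣ, (u : ZMod p) = (r : ZMod p) ∧ Subgroup.zpowers u = H) ∧
    s * (r - 1) ≡ -1 [ZMOD (p : ℤ)]

/-! Both isomorphisms come from counting: the relations bound the order of the presented group from
above, and concrete permutations satisfying them generate a group that attains the bound.

Upper bound. The first two relations force `a ^ p = b ^ κ = 1` and `b⁻¹ * a * b = a ^ r`
(`affine_relations`). As `b = g ^ 3` and `z = g ^ κ`, the elements `b` and `z` commute, `z ^ 3 = 1`,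
and `g` is recovered from them because 3 and `κ` are coprime. The conjugates `x_i` of `z` by `a ^ i`
are therefore indexed by `ZMod p`; conjugation by `a` translates the index and conjugation by `b`
multiplies it by `r`. This spreads `(z z^a)^2 = 1` to all pairs whose difference lies in `H` or
`-H`, that is, to all pairs. By Carmichael's bound the `x_i` generate a normal subgroup `N` of order
at most `(p + 2)! / 2` (`exists_normal_carmichael`). Modulo `N` only the metacyclic group of order
at most `p * κ` remains. The relator `h` puts `b ^ m` in `N`, with `m = 1` (alternating) or `m = 2`
(symmetric); as `r ^ m ≠ 1` modulo `p`, also `a` lies in `N`, and the quotient has order at most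
`m`.

Realization. On `ZMod p` with two added points, `a` and `b` act as affine maps fixing the added
points, and `z` as the 3-cycle on `0` and the added points. Pairing `a` and `b` with themselves in
`T`, and `z` with `1`, yields exactly the pairs of equal sign (`exists_realization`). The first
coordinate of `h` is trivial because its base has two nontrivial cycles, both of length `(p + 1) /
2` (`dilation_mul_threeCycle_pow`). -/

/-! ### Upper bounds for the orders of groups given by generators and relations -/

section UpperBounds

open scoped Pointwise

variable {G : Type*} [Group G]

/-- A union of finitely many right cosets of `K` which contains `1` and is stable under right
multiplication by the elements of `S` contains `closure S`. -/
theorem Subgroup.closure_le_of_mul_mem {S : Set G} (K : Subgroup G) (R : Set G)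
    (hone : ∃ q ∈ R, q ∈ K)
    (hmul : ∀ q ∈ R, ∀ x ∈ S, ∃ q' ∈ R, q * x * q'⁻¹ ∈ K)
    (hinv : ∀ x ∈ S, x⁻¹ ∈ Submonoid.closure S) :
    (Subgroup.closure S : Set G) ⊆ (K : Set G) * R := by
  have key : ∀ y ∈ Submonoid.closure S, ∀ w ∈ (K : Set G) * R, w * y ∈ (K : Set G) * R := by
    intro y hy
    induction hy using Submonoid.closure_induction with
    | mem x hx =>
      rintro w ⟨k, hk, q, hq, rfl⟩
      obtain ⟨q', hq', h⟩ := hmul q hq x hx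
      exact ⟨k * (q * x * q'⁻¹), K.mul_mem hk h, q', hq', by simp [mul_assoc]⟩
    | one => simp
    | mul x y _ _ hx hy =>
      intro w hw
      rw [← mul_assoc]
      exact hy _ (hx _ hw)
  have hle : Subgroup.closure S ≤
      { Submonoid.closure S with
        inv_mem' := by
          intro x hx
          induction hx using Submonoid.closure_induction with
          | mem x hx => exact hinv x hx
          | one => simp
          | mul x y _ _ hx hy =>
            simp only [mul_inv_rev]
            exact (Submonoid.closure S).mul_mem hy hx } :=
    (Subgroup.closure_le _).2 fun x hx => Submonoid.subset_closure hx
  intro y hy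
  obtain ⟨q, hq, hqK⟩ := hone
  have := key y (hle hy) 1 ⟨q⁻¹, K.inv_mem hqK, q, hq, by simp⟩
  simpa using this

theorem mul_eq_inv_mul_inv_of_sq_eq_one {x y : G} (h : (x * y) ^ 2 = 1) :
    x * y = y⁻¹ * x⁻¹ := by
  rw [← mul_inv_rev, eq_inv_iff_mul_eq_one, ← sq, h]

theorem sq_mul_comm_eq_one {x y : G} (h : (x * y) ^ 2 = 1) : (y * x) ^ 2 = 1 := by
  have : (y * x) ^ 2 = x⁻¹ * (x * y) ^ 2 * x := by simp [sq, mul_assoc]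
  rw [this, h]; simp

/-- **Carmichael's bound**: elements `x i` with `x i ^ 3 = 1` and `(x i * x j) ^ 2 = 1` for
distinct `i`, `j` generate a group of order at most `(n + 2)! / 2`, where `n` is their number. -/
theorem carmichael_card_le {ι : Type*} [DecidableEq ι] (x : ι → G) (hx : ∀ i, x i ^ 3 = 1)
    (hxy : ∀ i j, i ≠ j → (x i * x j) ^ 2 = 1) (s : Finset ι) :
    Finite (Subgroup.closure (x '' (s : Set ι))) ∧
      2 * Nat.card (Subgroup.closure (x '' (s : Set ι))) ≤ (s.card + 2).factorial := by
  induction s using Finset.induction_on with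
  | empty =>
    simp only [Finset.coe_empty, Set.image_empty, Subgroup.closure_empty]
    refine ⟨inferInstance, by simp⟩
  | insert n s hn ih =>
    obtain ⟨hfin, hcard⟩ := ih
    set K := Subgroup.closure (x '' (s : Set ι)) with hK
    have hxK : ∀ j ∈ s, x j ∈ K := fun j hj => Subgroup.subset_closure ⟨j, hj, rfl⟩
    have hinv : ∀ i, x i * x i = (x i)⁻¹ := fun i => by
      rw [eq_inv_iff_mul_eq_one, ← hx i, pow_succ, sq]
    have hinv' : ∀ i, (x i)⁻¹ * (x i)⁻¹ = x i := fun i => by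
      rw [← mul_inv_rev, hinv, inv_inv]
    have hc : ∀ i j, i ≠ j → x i * x j = (x j)⁻¹ * (x i)⁻¹ := fun i j hij =>
      mul_eq_inv_mul_inv_of_sq_eq_one (hxy i j hij)
    classical
    -- In the model, `x i` is a 3-cycle on `i` and two extra points and `K` fixes `n`. There is one
    -- coset for each possible position of `n` among the `s.card + 3` points.
    let R : Finset G := insert 1 (insert (x n) (insert (x n)⁻¹ (s.image fun j => (x n)⁻¹ * x j)))
    have hR : R.card ≤ s.card + 3 := by
      refine (Finset.card_insert_le _ _).trans ?_
      refine Nat.succ_le_succ ((Finset.card_insert_le _ _).trans ?_)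
      exact Nat.succ_le_succ ((Finset.card_insert_le _ _).trans
        (Nat.succ_le_succ Finset.card_image_le))
    have hsub : (Subgroup.closure (x '' (↑(insert n s) : Set ι)) : Set G) ⊆ (K : Set G) * (R : Set G) := by
      apply Subgroup.closure_le_of_mul_mem
      · exact ⟨1, Finset.mem_coe.2 (Finset.mem_insert_self _ _), K.one_mem⟩
      · have hne : ∀ j ∈ s, n ≠ j := fun j hj h => hn (h ▸ hj)
        have memj : ∀ j ∈ s, (x n)⁻¹ * x j ∈ (R : Set G) := fun j hj => by
          simp only [R, Finset.coe_insert, Set.mem_insert_iff, Finset.coe_image]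
          exact Or.inr (Or.inr (Or.inr ⟨j, hj, rfl⟩))
        have mem1 : (1 : G) ∈ (R : Set G) := by simp [R]
        have memn : x n ∈ (R : Set G) := by simp [R]
        have memn' : (x n)⁻¹ ∈ (R : Set G) := by simp [R]
        rintro q hq _ ⟨k, hk, rfl⟩
        have hk' : k = n ∨ k ∈ s := by simpa using hk
        have hq' : q = 1 ∨ q = x n ∨ q = (x n)⁻¹ ∨ ∃ j ∈ s, (x n)⁻¹ * x j = q := by
          simpa [R] using hq
        rcases hq' with rfl | rfl | rfl | ⟨j, hj, rfl⟩
        · rcases hk' with rfl | hk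
          · exact ⟨x k, memn, by simp⟩
          · exact ⟨1, mem1, by simpa using hxK k hk⟩
        · rcases hk' with rfl | hk
          · exact ⟨(x k)⁻¹, memn', by simp [hinv]⟩
          · refine ⟨(x n)⁻¹, memn', ?_⟩
            rw [hc n k (hne k hk)]
            simpa using hxK k hk
        · rcases hk' with rfl | hk
          · exact ⟨1, mem1, by simp⟩
          · exact ⟨(x n)⁻¹ * x k, memj k hk, by simp⟩
        · rcases hk' with rfl | hk
          · refine ⟨(x k)⁻¹ * x j, memj j hj, ?_⟩
            have : (x k)⁻¹ * x j * x k = (x j)⁻¹ * ((x k)⁻¹ * x j) := by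
              rw [mul_assoc, hc j k (hne j hj).symm, ← mul_assoc, hinv', ← mul_assoc,
                ← hc k j (hne j hj), mul_assoc, hinv]
            rw [this, mul_inv_cancel_right]
            exact K.inv_mem (hxK j hj)
          · rcases eq_or_ne j k with rfl | hjk
            · refine ⟨x n, memn, ?_⟩
              rw [mul_assoc (x n)⁻¹ (x j) (x j), hinv, ← hc j n (hne j hj).symm]
              simpa using hxK j hj
            · refine ⟨(x n)⁻¹ * x j, memj j hj, ?_⟩
              have : (x n)⁻¹ * x j * x k = x k * (x j)⁻¹ * ((x n)⁻¹ * x j) := by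
                rw [mul_assoc, hc j k hjk, ← mul_assoc, ← hc k n (hne k hk).symm, mul_assoc,
                  mul_assoc, ← mul_assoc _ _ (x j), ← hc n j (hne j hj), mul_assoc (x n), hinv]
              rw [this, mul_inv_cancel_right]
              exact K.mul_mem (hxK k hk) (K.inv_mem (hxK j hj))
      · rintro _ ⟨k, hk, rfl⟩
        rw [← hinv]
        have := Submonoid.subset_closure (Set.mem_image_of_mem x hk)
        exact Submonoid.mul_mem _ this this
    have hKfin : (K : Set G).Finite := Set.toFinite _
    have hfin' : ((K : Set G) * (R : Set G)).Finite := hKfin.mul R.finite_toSet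
    refine ⟨(hfin'.subset hsub).to_subtype, ?_⟩
    have h1 : Nat.card (Subgroup.closure (x '' (↑(insert n s) : Set ι))) ≤
        Nat.card K * (s.card + 3) := by
      refine (Nat.card_mono hfin' hsub).trans ((Set.natCard_mul_le).trans ?_)
      refine Nat.mul_le_mul le_rfl ?_
      simpa using hR
    rw [Finset.card_insert_of_notMem hn]
    calc _ ≤ 2 * (Nat.card K * (s.card + 3)) := Nat.mul_le_mul le_rfl h1
      _ = (s.card + 3) * (2 * Nat.card K) := by ring
      _ ≤ (s.card + 3) * (s.card + 2).factorial := Nat.mul_le_mul le_rfl hcard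
      _ = (s.card + 1 + 2).factorial := by rw [← Nat.factorial_succ]

theorem Subgroup.mem_normalizer_closure {S : Set G} {y : G}
    (h₁ : ∀ x ∈ S, y * x * y⁻¹ ∈ Subgroup.closure S)
    (h₂ : ∀ x ∈ S, y⁻¹ * x * y ∈ Subgroup.closure S) :
    y ∈ Subgroup.normalizer (Subgroup.closure S : Set G) := by
  have k₁ : ∀ w : G, (∀ x ∈ S, w * x * w⁻¹ ∈ Subgroup.closure S) →
      Subgroup.closure S ≤ (Subgroup.closure S).comap (MulAut.conj w).toMonoidHom := fun w hw =>
    (Subgroup.closure_le _).2 fun x hx => by simpa using hw x hx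
  rw [Subgroup.mem_normalizer_iff]
  refine fun x => ⟨fun hx => by simpa using k₁ y h₁ hx, fun hx => ?_⟩
  have := k₁ y⁻¹ (by simpa using h₂) hx
  simpa [mul_assoc] using this

theorem Subgroup.normal_of_closure_le_normalizer {S : Set G} {N : Subgroup G}
    (hS : Subgroup.closure S = ⊤) (h : ∀ y ∈ S, y ∈ Subgroup.normalizer (N : Set G)) : N.Normal := by
  rw [← Subgroup.normalizer_eq_top_iff, eq_top_iff, ← hS, Subgroup.closure_le]
  exact h

theorem zpow_eq_zpow_of_intCast_eq {p : ℕ} {a : G} (ha : a ^ p = 1) {m n : ℤ}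
    (h : (m : ZMod p) = n) : a ^ m = a ^ n := by
  rw [ZMod.intCast_eq_intCast_iff] at h
  rw [zpow_eq_zpow_iff_modEq]
  exact h.of_dvd (by exact_mod_cast orderOf_dvd_of_pow_eq_one ha)

theorem natCard_zpowers_le {b : G} {k : ℕ} (hk : 0 < k) (hb : b ^ k = 1) :
    Finite (Subgroup.zpowers b) ∧ Nat.card (Subgroup.zpowers b) ≤ k := by
  have hfin : IsOfFinOrder b := isOfFinOrder_iff_pow_eq_one.2 ⟨k, hk, hb⟩
  refine ⟨(Nat.finite_of_card_ne_zero ?_), ?_⟩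
  · rw [Nat.card_zpowers]; exact hfin.orderOf_pos.ne'
  · rw [Nat.card_zpowers]; exact Nat.le_of_dvd hk (orderOf_dvd_of_pow_eq_one hb)

/-- A group generated by `a`, `b` with `a ^ p = b ^ k = 1` where `b` normalizes `⟨a⟩` has order
at most `p * k`. -/
theorem metacyclic_card_le {a b : G} {p k : ℕ} {r t : ℤ} (hp : 0 < p) (hk : 0 < k)
    (hgen : Subgroup.closure {a, b} = ⊤) (ha : a ^ p = 1) (hb : b ^ k = 1)
    (hab : b⁻¹ * a * b = a ^ r) (hba : b * a * b⁻¹ = a ^ t) :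
    Finite G ∧ Nat.card G ≤ p * k := by
  have hN : (Subgroup.zpowers a).Normal := by
    refine Subgroup.normal_of_closure_le_normalizer hgen ?_
    rintro y (rfl | rfl)
    · exact Subgroup.le_normalizer (Subgroup.mem_zpowers y)
    · rw [Subgroup.zpowers_eq_closure]
      apply Subgroup.mem_normalizer_closure
      · rintro x rfl
        rw [hba, ← Subgroup.zpowers_eq_closure]
        exact ⟨t, rfl⟩
      · rintro x rfl
        rw [hab, ← Subgroup.zpowers_eq_closure]
        exact ⟨r, rfl⟩
  obtain ⟨fa, ca⟩ := natCard_zpowers_le hp ha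
  obtain ⟨fb, cb⟩ := natCard_zpowers_le hk hb
  have htop : (Set.univ : Set G) = (Subgroup.zpowers a : Set G) * (Subgroup.zpowers b : Set G) := by
    rw [← Subgroup.normal_mul, ← Subgroup.coe_top, ← hgen, Set.insert_eq,
      Subgroup.closure_union, ← Subgroup.zpowers_eq_closure, ← Subgroup.zpowers_eq_closure]
  have hf : ((Subgroup.zpowers a : Set G) * (Subgroup.zpowers b : Set G)).Finite :=
    (Set.toFinite _).mul (Set.toFinite _)
  refine ⟨Set.finite_univ_iff.1 (htop ▸ hf), ?_⟩
  calc Nat.card G = Nat.card (Set.univ : Set G) := Nat.card_univ.symm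
    _ ≤ _ := by rw [htop]; exact Set.natCard_mul_le
    _ ≤ _ := Nat.mul_le_mul ca cb

end UpperBounds

/-! ### Consequences of the relations and bounds for the orders -/

section Relations

variable {G : Type*} [Group G]

/-- The first two relations force `a ^ p = 1`, `b ^ k = 1` and `b⁻¹ * a * b = a ^ r`. -/
theorem affine_relations {a b : G} {p k : ℕ} {r s : ℤ} (hrs : s * (r - 1) ≡ -1 [ZMOD (p : ℤ)])
    (h₁ : a ^ p = b ^ k) (h₂ : b⁻¹ * a ^ s * b = a ^ (s - 1)) :
    a ^ p = 1 ∧ b ^ k = 1 ∧ b⁻¹ * a * b = a ^ r := by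
  have hconj : ∀ n : ℤ, b⁻¹ * a ^ (s * n) * b = a ^ ((s - 1) * n) := fun n => by
    rw [zpow_mul, zpow_mul, ← h₂]
    simpa using (conj_zpow (i := n) (a := b⁻¹) (b := a ^ s)).symm
  have hap : a ^ p = 1 := by
    -- Being a power of `b`, `a ^ p` commutes with `b`, so `hconj p` compares the powers `s` and `s
    -- - 1` of `a ^ p`.
    have hcomm : Commute b (a ^ p) := h₁ ▸ Commute.self_pow b k
    have h := hconj p
    rw [mul_comm s, zpow_mul, zpow_natCast, mul_assoc, ← (hcomm.zpow_right s).eq,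
      inv_mul_cancel_left, mul_comm, zpow_mul, zpow_natCast, zpow_sub, zpow_one] at h
    simpa using h
  refine ⟨hap, h₁ ▸ hap, ?_⟩
  have hrs' : (s : ZMod p) * (r - 1) = -1 := by
    have := (ZMod.intCast_eq_intCast_iff _ _ _).2 hrs
    push_cast at this
    exact this
  -- Modulo `p`, `s * (1 - r) = 1` and hence `(s - 1) * (1 - r) = r`.
  have h := hconj (1 - r)
  rw [zpow_eq_zpow_of_intCast_eq hap (n := 1) (by push_cast; linear_combination -hrs'),
    zpow_one, zpow_eq_zpow_of_intCast_eq hap (n := r)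
      (by push_cast; linear_combination -hrs')] at h
  exact h

theorem conj_inv_eq_zpow {a b : G} {p : ℕ} {r t : ℤ} (ha : a ^ p = 1)
    (hab : b⁻¹ * a * b = a ^ r) (hrt : (r : ZMod p) * t = 1) : b * a * b⁻¹ = a ^ t := by
  have h : b⁻¹ * a ^ t * b = a := by
    have h := conj_zpow (i := t) (a := b⁻¹) (b := a)
    rw [inv_inv, hab, ← zpow_mul,
      zpow_eq_zpow_of_intCast_eq ha (n := 1) (by push_cast; exact hrt), zpow_one] at h
    exact h.symm
  rw [mul_inv_eq_iff_eq_mul]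
  nth_rewrite 1 [← h]
  simp only [mul_assoc, mul_inv_cancel_left]

/-- By Bézout, `g` is a product of powers of `g ^ 3` and `g ^ k`. This trades `g` for the commuting
pair `b`, `z`. -/
theorem closure_pow_coprime {a g : G} {k : ℕ} (hk : Nat.Coprime 3 k) :
    Subgroup.closure {a, g ^ 3, g ^ k} = Subgroup.closure {a, g} := by
  apply le_antisymm
  · have hg : g ∈ Subgroup.closure {a, g} := Subgroup.subset_closure (by simp)
    rw [Subgroup.closure_le]
    rintro y (rfl | rfl | rfl)
    · exact Subgroup.subset_closure (by simp)
    · exact Subgroup.pow_mem _ hg _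
    · exact Subgroup.pow_mem _ hg _
  rw [Subgroup.closure_le]
  have h3 : g ^ 3 ∈ Subgroup.closure {a, g ^ 3, g ^ k} := Subgroup.subset_closure (by simp)
  have hk' : g ^ k ∈ Subgroup.closure {a, g ^ 3, g ^ k} := Subgroup.subset_closure (by simp)
  rintro y (rfl | rfl)
  · exact Subgroup.subset_closure (by simp)
  · have hb := Nat.gcd_eq_gcd_ab 3 k
    rw [hk.gcd_eq_one] at hb
    have : y = (y ^ 3) ^ Nat.gcdA 3 k * (y ^ k) ^ Nat.gcdB 3 k := by
      rw [← zpow_natCast y 3, ← zpow_natCast y k, ← zpow_mul, ← zpow_mul, ← zpow_add, ← hb]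
      simp
    have hmem := Subgroup.mul_mem _ (Subgroup.zpow_mem _ h3 (Nat.gcdA 3 k))
      (Subgroup.zpow_mem _ hk' (Nat.gcdB 3 k))
    rwa [← this] at hmem

/-- The conjugates of `z` by the powers of `a` satisfy Carmichael's relations, and generate a
normal subgroup. -/
theorem exists_normal_carmichael {p : ℕ} [Fact p.Prime] {H : Subgroup (ZMod p)ˣ} {r : ℤ}
    {u : (ZMod p)ˣ} (hu : (u : ZMod p) = r) (huH : Subgroup.zpowers u = H)
    (hH : ∀ d : (ZMod p)ˣ, d ∈ H ∨ -d ∈ H) {a b z : G}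
    (hgen : Subgroup.closure {a, b, z} = ⊤) (ha : a ^ p = 1) (hab : b⁻¹ * a * b = a ^ r)
    (hz : z ^ 3 = 1) (hbz : Commute b z) (hza : (z * (a⁻¹ * z * a)) ^ 2 = 1) :
    ∃ N : Subgroup G, N.Normal ∧ Finite N ∧ 2 * Nat.card N ≤ (p + 2).factorial ∧ z ∈ N := by
  let X : ℤ → G := fun n => a ^ (-n) * z * a ^ n
  have hX : ∀ m n : ℤ, (m : ZMod p) = n → X m = X n := fun m n h => by
    simp only [X, zpow_neg]
    rw [zpow_eq_zpow_of_intCast_eq ha h]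
  have hXa : ∀ m n : ℤ, a ^ (-m) * X n * a ^ m = X (n + m) := fun m n => by
    simp only [X]
    rw [zpow_add a n m, neg_add_rev, zpow_add]
    simp only [mul_assoc]
  have hXb : ∀ n : ℤ, b⁻¹ * X n * b = X (r * n) := fun n => by
    have h1 : ∀ m : ℤ, b⁻¹ * a ^ m * b = a ^ (r * m) := fun m => by
      rw [zpow_mul, ← hab]
      simpa using (conj_zpow (i := m) (a := b⁻¹) (b := a)).symm
    have h2 : b⁻¹ * z * b = z := by rw [mul_assoc, ← hbz.eq, inv_mul_cancel_left]
    calc b⁻¹ * X n * b = (b⁻¹ * a ^ (-n) * b) * (b⁻¹ * z * b) * (b⁻¹ * a ^ n * b) := by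
          simp only [X, mul_assoc, mul_inv_cancel_left]
      _ = X (r * n) := by rw [h1, h2, h1, mul_neg]
  have hX3 : ∀ n, X n ^ 3 = 1 := fun n => by
    have := conj_pow (i := 3) (a := a ^ (-n)) (b := z)
    rw [zpow_neg, inv_inv, ← zpow_neg, hz] at this
    simp only [X]
    rw [this]; simp
  have conj2 : ∀ c x y : G, (x * y) ^ 2 = 1 → (c⁻¹ * x * c * (c⁻¹ * y * c)) ^ 2 = 1 := by
    intro c x y h
    have : (c⁻¹ * x * c * (c⁻¹ * y * c)) ^ 2 = c⁻¹ * (x * y) ^ 2 * c := by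
      simp only [sq, mul_assoc, mul_inv_cancel_left]
    rw [this, h]; simp
  -- Conjugation by `b` fixes `X 0 = z` and multiplies the other index by `r`.
  have h0 : ∀ k : ℕ, (X 0 * X (r ^ k)) ^ 2 = 1 := by
    intro k
    induction k with
    | zero => simpa [X] using hza
    | succ k ih =>
      have := conj2 b _ _ ih
      rwa [hXb, hXb, mul_zero, ← pow_succ'] at this
  have h1 : ∀ (k : ℕ) (m : ℤ), (X m * X (m + r ^ k)) ^ 2 = 1 := by
    intro k m
    have := conj2 (a ^ m) _ _ (h0 k)
    rwa [← zpow_neg, hXa, hXa, zero_add, add_comm] at this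
  have h2 : ∀ m n : ℤ, (∃ d : (ZMod p)ˣ, d ∈ H ∧ (n : ZMod p) = m + d) →
      (X m * X n) ^ 2 = 1 := by
    rintro m n ⟨d, hd, hn⟩
    rw [← huH, ← mem_powers_iff_mem_zpowers] at hd
    obtain ⟨k, rfl⟩ := hd
    rw [hX n (m + r ^ k) (by rw [hn]; push_cast; rw [hu])]
    exact h1 k m
  let x : ZMod p → G := fun i => X i.val
  have hxy : ∀ i j, i ≠ j → (x i * x j) ^ 2 = 1 := by
    intro i j hij
    have hd : j - i ≠ 0 := sub_ne_zero.2 hij.symm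
    -- If only `i - j` lies in `H`, the relation is available in the opposite order, and `(x * y) ^
    -- 2 = 1` is symmetric in `x` and `y`.
    rcases hH (Units.mk0 _ hd) with h | h
    · exact h2 _ _ ⟨_, h, by simp⟩
    · exact sq_mul_comm_eq_one (h2 _ _ ⟨_, h, by simp⟩)
  obtain ⟨hfin, hcard⟩ := carmichael_card_le x (fun i => hX3 _) hxy Finset.univ
  rw [Finset.card_univ, ZMod.card] at hcard
  have hmem : ∀ n : ℤ, X n ∈ Subgroup.closure (x '' ((Finset.univ : Finset (ZMod p)) : Set (ZMod p))) :=
    fun n => Subgroup.subset_closure ⟨n, by simp, hX _ _ (by simp)⟩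
  have hzX : z = X 0 := by simp [X]
  refine ⟨_, Subgroup.normal_of_closure_le_normalizer hgen ?_, hfin, hcard, hzX ▸ hmem 0⟩
  rintro y (rfl | rfl | rfl)
  · apply Subgroup.mem_normalizer_closure
    · rintro _ ⟨i, _, rfl⟩
      have := hXa (-1) i.val
      rw [neg_neg, zpow_one, zpow_neg, zpow_one] at this
      rw [this]
      exact hmem _
    · rintro _ ⟨i, _, rfl⟩
      have := hXa 1 i.val
      rw [zpow_one, zpow_neg, zpow_one] at this
      rw [this]
      exact hmem _
  · apply Subgroup.mem_normalizer_closure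
    · rintro _ ⟨i, _, rfl⟩
      have hi : x i = X (r * (((u⁻¹ : (ZMod p)ˣ) : ZMod p) * i).val) := hX _ _ (by
        push_cast
        rw [ZMod.natCast_zmod_val, ZMod.natCast_zmod_val, ← hu, mul_inv_cancel_left₀ u.ne_zero])
      have hcancel : ∀ w : G, y * (y⁻¹ * w * y) * y⁻¹ = w := fun w => by simp [mul_assoc]
      rw [hi, ← hXb, hcancel]
      exact hmem _
    · rintro _ ⟨i, _, rfl⟩
      rw [hXb]
      exact hmem _
  · rw [hzX]
    exact Subgroup.le_normalizer (hmem 0)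

theorem finite_and_card_le_of_quotient {N : Subgroup G} [Finite N] {m n : ℕ}
    (hN : 2 * Nat.card N ≤ m) (hQ : Finite (G ⧸ N) ∧ Nat.card (G ⧸ N) ≤ n) :
    Finite G ∧ 2 * Nat.card G ≤ m * n := by
  obtain ⟨hQ, hn⟩ := hQ
  refine ⟨Finite.of_equiv _ (Subgroup.groupEquivQuotientProdSubgroup (s := N)).symm, ?_⟩
  rw [Subgroup.card_eq_card_quotient_mul_card_subgroup N]
  calc _ = 2 * Nat.card N * Nat.card (G ⧸ N) := by ring
    _ ≤ _ := Nat.mul_le_mul hN hn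

/-- The hypotheses on a subgroup `H` of the unit group of `ZMod p` under which the
presentations are studied. -/
structure IsGoodSubgroup (p : ℕ) (H : Subgroup (ZMod p)ˣ) (κ : ℕ) : Prop where
  card : Nat.card H = κ
  coprime : Nat.Coprime 3 κ
  mem_or_neg_mem : ∀ d : (ZMod p)ˣ, d ∈ H ∨ -d ∈ H

/-- Under the relations, `G` is an extension of a group generated by `a` and `b` by a group of
order at most `(p + 2)! / 2`. -/
theorem relations_structure {p : ℕ} [Fact p.Prime] {H : Subgroup (ZMod p)ˣ} {κ : ℕ}
    (hgood : IsGoodSubgroup p H κ) {r s : ℤ} (hrs : IsParam p H r s) {a g : G}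
    (hgen : Subgroup.closure {a, g} = ⊤)
    (h₁ : a ^ p = (g ^ 3) ^ κ) (h₂ : conjBy (a ^ s) (g ^ 3) = a ^ (s - 1))
    (h₃ : (g ^ κ * conjBy (g ^ κ) a) ^ 2 = 1) :
    a ^ p = 1 ∧ (g ^ 3) ^ κ = 1 ∧ (g ^ 3)⁻¹ * a * g ^ 3 = a ^ r ∧
      (∃ t : ℤ, (g ^ 3) * a * (g ^ 3)⁻¹ = a ^ t) ∧
    ∃ N : Subgroup G, ∃ _ : N.Normal, Finite N ∧ 2 * Nat.card N ≤ (p + 2).factorial ∧ g ^ κ ∈ N ∧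
      Subgroup.closure {QuotientGroup.mk' N a, QuotientGroup.mk' N (g ^ 3)} = ⊤ := by
  obtain ⟨⟨u, hu, huH⟩, hs⟩ := hrs
  obtain ⟨ha, hb, hab⟩ := affine_relations hs h₁ h₂
  have hgen' := (closure_pow_coprime hgood.coprime).trans hgen
  refine ⟨ha, hb, hab, ⟨((u⁻¹ : (ZMod p)ˣ) : ZMod p).val,
    conj_inv_eq_zpow ha hab (by
      push_cast
      rw [ZMod.natCast_zmod_val, ← hu, mul_inv_cancel₀ u.ne_zero])⟩, ?_⟩
  obtain ⟨N, hN, hfin, hcard, hz⟩ := exists_normal_carmichael hu huH hgood.mem_or_neg_mem hgen' ha hab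
    (by rw [← pow_mul, mul_comm, pow_mul, hb]) ((Commute.refl g).pow_pow 3 κ) h₃
  refine ⟨N, hN, hfin, hcard, hz, ?_⟩
  have h := congrArg (Subgroup.map (QuotientGroup.mk' N)) hgen'
  rw [MonoidHom.map_closure, ← MonoidHom.range_eq_map, QuotientGroup.range_mk',
    Set.image_insert_eq, Set.image_pair] at h
  rw [eq_top_iff, ← h, Subgroup.closure_le]
  rintro y (rfl | rfl | rfl)
  · exact Subgroup.subset_closure (by simp)
  · exact Subgroup.subset_closure (by simp)
  · have h1 : QuotientGroup.mk' N (g ^ κ) = 1 := (QuotientGroup.eq_one_iff _).2 hz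
    rw [h1]
    exact Subgroup.one_mem _

/-- Modulo `N` the element `z` dies, and what is left is generated by `a` and `b` with the
metacyclic relations. -/
theorem card_le_of_relations {p : ℕ} [Fact p.Prime] {H : Subgroup (ZMod p)ˣ} {κ : ℕ}
    (hgood : IsGoodSubgroup p H κ) (hκ : 0 < κ) {r s : ℤ} (hrs : IsParam p H r s) {a g : G}
    (hgen : Subgroup.closure {a, g} = ⊤)
    (h₁ : a ^ p = (g ^ 3) ^ κ) (h₂ : conjBy (a ^ s) (g ^ 3) = a ^ (s - 1))
    (h₃ : (g ^ κ * conjBy (g ^ κ) a) ^ 2 = 1) :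
    Finite G ∧ 2 * Nat.card G ≤ (p + 2).factorial * (p * κ) := by
  obtain ⟨ha, hb, hab, ⟨t, hba⟩, N, hN, hfin, hcard, hz, hQ⟩ :=
    relations_structure hgood hrs hgen h₁ h₂ h₃
  refine finite_and_card_le_of_quotient hcard (metacyclic_card_le (Fact.out : p.Prime).pos hκ hQ
    (r := r) (t := t) ?_ ?_ ?_ ?_)
  · rw [← map_pow, ha, map_one]
  · rw [← map_pow, hb, map_one]
  · rw [← map_inv, ← map_mul, ← map_mul, hab, map_zpow]
  · rw [← map_inv, ← map_mul, ← map_mul, hba, map_zpow]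

/-- If moreover some power `b ^ m` lies in every normal subgroup containing `z`, where `b ^ m` does
not centralize `a`, then the order is at most `(p + 2)! / 2 * m`. -/
theorem card_le_of_relations_of_pow {p : ℕ} [Fact p.Prime] {H : Subgroup (ZMod p)ˣ} {κ : ℕ}
    (hgood : IsGoodSubgroup p H κ) {r s : ℤ} (hrs : IsParam p H r s) {a g : G}
    (hgen : Subgroup.closure {a, g} = ⊤)
    (h₁ : a ^ p = (g ^ 3) ^ κ) (h₂ : conjBy (a ^ s) (g ^ 3) = a ^ (s - 1))
    (h₃ : (g ^ κ * conjBy (g ^ κ) a) ^ 2 = 1) {m : ℕ} (hm : 0 < m) (hrm : (r : ZMod p) ^ m ≠ 1)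
    (hbm : (g ^ 3) ^ κ = 1 → ∀ N : Subgroup G, N.Normal → g ^ κ ∈ N → (g ^ 3) ^ m ∈ N) :
    Finite G ∧ 2 * Nat.card G ≤ (p + 2).factorial * m := by
  obtain ⟨ha, hb, hab, ⟨t, hba⟩, N, hN, hfin, hcard, hz, hQ⟩ :=
    relations_structure hgood hrs hgen h₁ h₂ h₃
  set A := QuotientGroup.mk' N a with hA
  set B := QuotientGroup.mk' N (g ^ 3) with hB
  have hAp : A ^ p = 1 := by rw [hA, ← map_pow, ha, map_one]
  have hBm : B ^ m = 1 := by
    rw [hB, ← map_pow]; exact (QuotientGroup.eq_one_iff _).2 (hbm hb N hN hz)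
  have hAB : B⁻¹ * A * B = A ^ r := by
    rw [hA, hB, ← map_inv, ← map_mul, ← map_mul, hab, map_zpow]
  have hpow : ∀ k : ℕ, (B ^ k)⁻¹ * A * B ^ k = A ^ (r ^ k) := by
    intro k
    induction k with
    | zero => simp
    | succ k ih =>
      calc (B ^ (k + 1))⁻¹ * A * B ^ (k + 1) = B⁻¹ * ((B ^ k)⁻¹ * A * B ^ k) * B := by
            rw [pow_succ]; simp only [mul_inv_rev, mul_assoc]
        _ = (B⁻¹ * A * B) ^ (r ^ k) := by
            rw [ih]
            simpa using (conj_zpow (i := r ^ k) (a := B⁻¹) (b := A)).symm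
        _ = A ^ (r ^ (k + 1)) := by rw [hAB, ← zpow_mul, pow_succ']
  -- Since `B ^ m = 1`, conjugating by it gives `A ^ (r ^ m - 1) = 1`, and `r ^ m - 1` is invertible
  -- modulo `p`.
  have hA1 : A = 1 := by
    have h := hpow m
    rw [hBm, inv_one, one_mul, mul_one] at h
    have hne : (r : ZMod p) ^ m - 1 ≠ 0 := sub_ne_zero.2 hrm
    have h1 : A ^ (r ^ m - 1) = 1 := by rw [zpow_sub, ← h]; simp
    have h2 : A ^ ((r ^ m - 1) * ((((r : ZMod p) ^ m - 1)⁻¹).val : ℤ)) = 1 := by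
      rw [zpow_mul, h1, one_zpow]
    rw [zpow_eq_zpow_of_intCast_eq hAp (n := 1)
      (by push_cast; rw [ZMod.natCast_zmod_val, mul_inv_cancel₀ hne]), zpow_one] at h2
    exact h2
  refine finite_and_card_le_of_quotient hcard ?_
  -- With `A = 1` the quotient is cyclic, generated by `B`; this is the metacyclic bound with `p :=
  -- 1`.
  have := metacyclic_card_le (p := 1) (r := 1) (t := 1) one_pos hm hQ (by simp [hA1]) hBm (by simp [hA1])
    (by simp [hA1])
  simpa using this

end Relations

/-! ### 3-cycles through two added points -/

section Permutations

open Equiv Equiv.Perm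

/-- The permutation of `α ⊕ Bool` induced by a permutation of `α`. -/
def extendPerm (α : Type*) : Perm α →* Perm (α ⊕ Bool) :=
  (Perm.sumCongrHom α Bool).comp (MonoidHom.inl _ _)

@[simp] theorem extendPerm_inl {α : Type*} (σ : Perm α) (i : α) : extendPerm α σ (.inl i) = .inl (σ i) := rfl

@[simp] theorem extendPerm_inr {α : Type*} (σ : Perm α) (e : Bool) :
    extendPerm α σ (.inr e) = .inr e := rfl

variable {α : Type*} [DecidableEq α]

theorem sign_extendPerm [Fintype α] (σ : Perm α) : sign (extendPerm α σ) = sign σ := by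
  exact (sign_sumCongr σ (1 : Perm Bool)).trans (by simp)

/-- The 3-cycle on the point `i` and the two added points. -/
def threeCycle (i : α) : Perm (α ⊕ Bool) :=
  swap (.inl i) (.inr false) * swap (.inl i) (.inr true)

theorem sign_threeCycle [Fintype α] (i : α) : sign (threeCycle i) = 1 := by
  simp [threeCycle]

theorem extendPerm_conj_threeCycle (σ : Perm α) (i : α) :
    extendPerm α σ * threeCycle i * (extendPerm α σ)⁻¹ = threeCycle (σ i) := by
  have h : ∀ e : Bool, swap (.inl (σ i)) (.inr e) =
      extendPerm α σ * swap (.inl i) (.inr e) * (extendPerm α σ)⁻¹ := fun e => by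
    rw [← swap_apply_apply, extendPerm_inl, extendPerm_inr]
  rw [threeCycle, threeCycle, h, h]
  simp [mul_assoc]

theorem threeCycle_pow_three (i : α) : threeCycle i ^ 3 = 1 := by
  ext x
  rcases x with x | _ | _
  · by_cases h : x = i <;> simp [pow_succ, threeCycle, swap_apply_def, Perm.mul_apply, h]
  · simp [pow_succ, threeCycle, swap_apply_def, Perm.mul_apply]
  · simp [pow_succ, threeCycle, swap_apply_def, Perm.mul_apply]

/-- The product is a pair of disjoint transpositions. This explains Carmichael's relations and,
later, the cycle structure of `h`. -/
theorem threeCycle_mul {i j : α} (hij : i ≠ j) : threeCycle i * threeCycle j =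
    swap (.inl i) (.inr true) * swap (.inl j) (.inr false) := by
  ext x
  rcases x with x | _ | _
  · simp only [threeCycle, swap_apply_def, Perm.mul_apply]
    by_cases h : x = i <;> by_cases h' : x = j <;> simp_all
  · simp [threeCycle, swap_apply_def, Perm.mul_apply, hij.symm]
  · simp [threeCycle, swap_apply_def, Perm.mul_apply]

theorem threeCycle_mul_sq {i j : α} (hij : i ≠ j) : (threeCycle i * threeCycle j) ^ 2 = 1 := by
  rw [threeCycle_mul hij]
  ext x
  rcases x with x | _ | _
  · simp only [sq, swap_apply_def, Perm.mul_apply]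
    by_cases h : x = i <;> by_cases h' : x = j <;> simp_all
  · simp [sq, swap_apply_def, Perm.mul_apply, hij.symm]
  · simp [sq, swap_apply_def, Perm.mul_apply, hij]

/-- The 3-cycles through the two added points generate the alternating group. -/
theorem mem_closure_threeCycle [Fintype α] {σ : Perm (α ⊕ Bool)} (hσ : sign σ = 1) :
    σ ∈ Subgroup.closure (Set.range (threeCycle (α := α))) := by
  set M := Subgroup.closure (Set.range (threeCycle (α := α))) with hM
  -- Conjugation by `τ` inverts every generator, so `M ∪ M * τ` is a subgroup. It contains all
  -- transpositions, hence everything, and parity singles out `M`.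
  let τ : Perm (α ⊕ Bool) := swap (.inr false) (.inr true)
  have hτ : τ * τ = 1 := swap_mul_self _ _
  have hτinv : τ⁻¹ = τ := swap_inv _ _
  have hmem : ∀ i : α, threeCycle i ∈ M := fun i => Subgroup.subset_closure ⟨i, rfl⟩
  have hconj : ∀ i : α, τ * threeCycle i * τ = (threeCycle i)⁻¹ := fun i => by
    rw [eq_inv_iff_mul_eq_one]
    ext x
    rcases x with x | _ | _
    · simp only [τ, threeCycle, swap_apply_def, Perm.mul_apply]
      by_cases h : x = i <;> simp_all
    · simp [τ, threeCycle, swap_apply_def, Perm.mul_apply]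
    · simp [τ, threeCycle, Perm.mul_apply]
  have hnorm : ∀ m ∈ M, τ * m * τ ∈ M := by
    intro m hm
    induction hm using Subgroup.closure_induction with
    | mem x hx =>
      obtain ⟨i, rfl⟩ := hx
      rw [hconj]
      exact M.inv_mem (hmem i)
    | one => simp [hτ]
    | mul x y _ _ hx hy =>
      have : τ * (x * y) * τ = τ * x * τ * (τ * y * τ) := by
        simp only [mul_assoc]
        rw [← mul_assoc τ τ, hτ, one_mul]
      rw [this]
      exact M.mul_mem hx hy
    | inv x _ hx =>
      have := M.inv_mem hx
      simpa [hτinv, mul_assoc] using this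
  let K : Subgroup (Perm (α ⊕ Bool)) :=
    { carrier := {σ | σ ∈ M ∨ σ * τ ∈ M}
      one_mem' := Or.inl M.one_mem
      mul_mem' := by
        rintro x y (hx | hx) (hy | hy)
        · exact Or.inl (M.mul_mem hx hy)
        · exact Or.inr (by rw [mul_assoc]; exact M.mul_mem hx hy)
        · refine Or.inr ?_
          have := M.mul_mem hx (hnorm y hy)
          rwa [← mul_assoc, ← mul_assoc, mul_assoc x, hτ, mul_one] at this
        · refine Or.inl ?_
          have := M.mul_mem hx (hnorm _ hy)
          rwa [mul_assoc, mul_assoc, mul_assoc, hτ, mul_one, ← mul_assoc, ← mul_assoc, mul_assoc x, hτ, mul_one] at this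
      inv_mem' := by
        rintro x (hx | hx)
        · exact Or.inl (M.inv_mem hx)
        · refine Or.inr ?_
          have := hnorm _ (M.inv_mem hx)
          rwa [mul_inv_rev, hτinv, ← mul_assoc, hτ, one_mul] at this }
  have hKτ : τ ∈ K := Or.inr (by rw [hτ]; exact M.one_mem)
  have hKi : ∀ i : α, swap (.inl i) (.inr false) ∈ K := fun i => by
    refine Or.inr ?_
    have : swap (.inl i) (.inr false) * τ = (threeCycle i)⁻¹ := by
      rw [eq_inv_iff_mul_eq_one]
      ext x
      rcases x with x | _ | _
      · simp only [τ, threeCycle, swap_apply_def, Perm.mul_apply]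
        by_cases h : x = i <;> simp_all
      · simp [τ, threeCycle, swap_apply_def, Perm.mul_apply]
      · simp [τ, threeCycle, swap_apply_def, Perm.mul_apply]
    rw [this]
    exact M.inv_mem (hmem i)
  have hstar : ∀ x : α ⊕ Bool, swap x (.inr false) ∈ K := by
    rintro (i | _ | _)
    · exact hKi i
    · rw [swap_self]; exact K.one_mem
    · rw [swap_comm]; exact hKτ
  have hswap : ∀ x y : α ⊕ Bool, swap x y ∈ K := fun x y =>
    SubmonoidClass.swap_mem_trans K (hstar x) (by rw [swap_comm]; exact hstar y)
  have htop : ∀ σ, σ ∈ K := fun σ => by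
    induction σ using swap_induction_on with
    | one => exact K.one_mem
    | swap_mul f x y _ ih => exact K.mul_mem (hswap x y) ih
  rcases htop σ with h | h
  · exact h
  · have hle : ∀ m ∈ M, sign m = 1 := fun m hm => by
      have : M ≤ (sign : Perm (α ⊕ Bool) →* ℤˣ).ker := (Subgroup.closure_le _).2 (by
        rintro _ ⟨i, rfl⟩
        exact sign_threeCycle i)
      exact this hm
    have := hle _ h
    simp [hσ, τ] at this

end Permutations

/-! ### Generators, order and signs of the affine groups -/

section AffinePermutations

open Equiv Equiv.Perm

variable {p : ℕ}

/-- Multiplication by a unit, as a permutation of `ZMod p`. -/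
def dilation (p : ℕ) : (ZMod p)ˣ →* Perm (ZMod p) := MulAction.toPermHom (ZMod p)ˣ (ZMod p)

@[simp] theorem dilation_apply (u : (ZMod p)ˣ) (x : ZMod p) : dilation p u x = u * x := rfl

theorem dilation_injective : Function.Injective (dilation p) := fun u v h => by
  have := congrArg (fun σ : Perm (ZMod p) => σ 1) h
  exact Units.ext (by simpa using this)

variable {H : Subgroup (ZMod p)ˣ}

theorem addRight_mem_affineSubgroup (c : ZMod p) : Equiv.addRight c ∈ affineSubgroup p H :=
  ⟨1, H.one_mem, c, fun x => by simp⟩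

theorem dilation_mem_affineSubgroup {u : (ZMod p)ˣ} (hu : u ∈ H) :
    dilation p u ∈ affineSubgroup p H :=
  ⟨u, hu, 0, fun x => by simp⟩

/-- The translation `x ↦ x - 1`. -/
def affineA (p : ℕ) (H : Subgroup (ZMod p)ˣ) : affineSubgroup p H :=
  ⟨Equiv.addRight (-1), addRight_mem_affineSubgroup _⟩

/-- The dilation by the inverse of an element `u` of `H`. -/
def affineB {u : (ZMod p)ˣ} (hu : u ∈ H) : affineSubgroup p H :=
  ⟨dilation p u⁻¹, dilation_mem_affineSubgroup (H.inv_mem hu)⟩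

theorem affineA_zpow_apply (n : ℤ) (x : ZMod p) :
    ((affineA p H ^ n : affineSubgroup p H) : Perm (ZMod p)) x = x - n := by
  rw [Subgroup.coe_zpow]
  simp [affineA, sub_eq_add_neg]

theorem affineA_pow_eq_one : affineA p H ^ p = 1 := by
  ext x
  have := affineA_zpow_apply (H := H) p x
  rw [zpow_natCast] at this
  simpa using this

theorem affineB_pow_eq_one {u : (ZMod p)ˣ} (hu : u ∈ H) : affineB hu ^ Nat.card H = 1 := by
  have h : u ^ Nat.card H = 1 := by
    exact congrArg Subtype.val (pow_card_eq_one' (x := (⟨u, hu⟩ : H)))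
  refine Subtype.ext ?_
  rw [Subgroup.coe_pow, affineB, ← map_pow, inv_pow, h]
  simp

/-- With `x^y = y⁻¹ x y` and permutations composed as functions, it is the dilation by `u⁻¹` that
conjugates the translation `a` to `a ^ u`; this is why `affineB` uses the inverse. -/
theorem affine_conj {u : (ZMod p)ˣ} (hu : u ∈ H) {s : ℤ} (hs : (u : ZMod p) * s = s - 1) :
    conjBy (affineA p H ^ s) (affineB hu) = affineA p H ^ (s - 1) := by
  rw [conjBy, mul_assoc, inv_mul_eq_iff_eq_mul]
  ext x
  rw [Subgroup.coe_mul, Subgroup.coe_mul, Perm.mul_apply, Perm.mul_apply, affineA_zpow_apply,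
    affineA_zpow_apply, affineB, dilation_apply, dilation_apply]
  push_cast
  rw [← hs, mul_sub, ← mul_assoc, Units.inv_mul, one_mul]

theorem affineSubgroup_closure {u : (ZMod p)ˣ} (hu : u ∈ H) (huH : Subgroup.zpowers u = H) :
    Subgroup.closure {affineA p H, affineB hu} = ⊤ := by
  rw [eq_top_iff]
  rintro ⟨σ, α, hα, β, hσ⟩ -
  rw [← huH] at hα
  obtain ⟨k, rfl⟩ := hα
  obtain ⟨n, hn⟩ := ZMod.intCast_surjective (-β)
  have : (⟨σ, u ^ k, hα, β, hσ⟩ : affineSubgroup p H) = affineA p H ^ n * affineB hu ^ (-k) := by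
    ext x
    rw [Subgroup.coe_mul, Perm.mul_apply, affineA_zpow_apply, Subgroup.coe_zpow, affineB,
      ← map_zpow, dilation_apply, hn, inv_zpow, zpow_neg, inv_inv]
    simp [hσ]
  rw [this]
  exact Subgroup.mul_mem _ (Subgroup.zpow_mem _ (Subgroup.subset_closure (by simp)) _)
    (Subgroup.zpow_mem _ (Subgroup.subset_closure (by simp)) _)

/-- A lower bound is enough: it is compared with the upper bound for the presented group. -/
theorem card_affineSubgroup_ge [Fact p.Prime] :
    p * Nat.card H ≤ Nat.card (affineSubgroup p H) := by
  let f : ZMod p × H → affineSubgroup p H := fun x =>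
    ⟨Equiv.addRight x.1 * dilation p x.2, (affineSubgroup p H).mul_mem
      (addRight_mem_affineSubgroup _) (dilation_mem_affineSubgroup x.2.2)⟩
  have hf : Function.Injective f := by
    rintro ⟨c, u⟩ ⟨d, v⟩ h
    have h' : ∀ x : ZMod p, ((u : (ZMod p)ˣ) : ZMod p) * x + c = ((v : (ZMod p)ˣ) : ZMod p) * x + d := fun x =>
      congrArg (fun σ : affineSubgroup p H => (σ : Perm (ZMod p)) x) h
    have h0 : c = d := by simpa using h' 0
    have h1 := h' 1
    subst h0
    simp only [mul_one, add_left_inj, Units.val_inj, SetLike.coe_eq_coe] at h1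
    rw [h1]
  have := Nat.card_le_card_of_injective f hf
  rwa [Nat.card_prod, Nat.card_zmod] at this

theorem sign_addRight [Fact p.Prime] (hp : p ≠ 2) (c : ZMod p) : sign (Equiv.addRight c) = 1 := by
  have hodd : Odd p := (Fact.out : p.Prime).odd_of_ne_two hp
  have h : Equiv.addRight c ^ p = 1 := by
    ext x; simp
  have := congrArg sign h
  rw [map_pow, map_one] at this
  rcases Int.units_eq_one_or (sign (Equiv.addRight c)) with h | h
  · exact h
  · rw [h, hodd.neg_one_pow] at this
    exact absurd this (by decide)

theorem sign_eq_one_of_mem_AGL1Sq [Fact p.Prime] (hp : p ≠ 2) {σ : Perm (ZMod p)}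
    (hσ : σ ∈ AGL1Sq p) : sign σ = 1 := by
  obtain ⟨_, ⟨w, rfl⟩, β, hσ⟩ := hσ
  have : σ = Equiv.addRight β * dilation p w ^ 2 := by
    ext x
    rw [hσ, ← map_pow, Perm.mul_apply, dilation_apply]
    rfl
  rw [this, map_mul, map_pow, sign_addRight hp, Int.units_sq, one_mul]

/-- Such a dilation fixes `0` and permutes the units in a single cycle, whose length `p - 1` is
even. -/
theorem sign_dilation_of_zpowers_eq_top [Fact p.Prime] (hp : p ≠ 2) {u : (ZMod p)ˣ}
    (hu : Subgroup.zpowers u = ⊤) : sign (dilation p u) = -1 := by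
  have hord : orderOf u = p - 1 := by
    rw [← Nat.card_zpowers, hu, Nat.card_congr Subgroup.topEquiv.toEquiv, Nat.card_eq_fintype_card,
      ZMod.card_units]
  have h2 := (Fact.out : p.Prime).two_le
  have hu1 : u ≠ 1 := by
    rintro rfl
    rw [orderOf_one] at hord
    omega
  have hcyc : (dilation p u).IsCycle := by
    refine ⟨1, ?_, fun y hy => ?_⟩
    · rw [dilation_apply, mul_one]
      exact fun h => hu1 (Units.ext h)
    · have hy0 : y ≠ 0 := by rintro rfl; simp at hy
      have : Units.mk0 y hy0 ∈ Subgroup.zpowers u := hu ▸ Subgroup.mem_top _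
      obtain ⟨k, hk⟩ := this
      refine ⟨k, ?_⟩
      rw [← map_zpow, dilation_apply, mul_one]
      exact congrArg Units.val hk
  rw [hcyc.sign, ← hcyc.orderOf, orderOf_injective _ dilation_injective, hord,
    Even.neg_one_pow ((Fact.out : p.Prime).even_sub_one hp)]

end AffinePermutations

/-! ### Squares modulo `p` and the choice of parameters -/

section UnitSquares

variable {p : ℕ} [Fact p.Prime]

theorem index_unitSquares (hp : p ≠ 2) : (unitSquares p).index = 2 := by
  rw [unitSquares, IsCyclic.index_powMonoidHom_range, Nat.card_eq_fintype_card, ZMod.card_units]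
  exact Nat.gcd_eq_right ((Fact.out : p.Prime).even_sub_one hp).two_dvd

theorem card_unitSquares (hp : p ≠ 2) : Nat.card (unitSquares p) = (p - 1) / 2 := by
  have h := (unitSquares p).card_mul_index
  rw [index_unitSquares hp, Nat.card_eq_fintype_card (α := (ZMod p)ˣ), ZMod.card_units] at h
  omega

theorem neg_one_notMem_unitSquares (hp : p % 4 = 3) : (-1 : (ZMod p)ˣ) ∉ unitSquares p := by
  rintro ⟨w, hw⟩
  refine ZMod.exists_sq_eq_neg_one_iff.1 ⟨w, ?_⟩ hp
  have := congrArg Units.val hw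
  simp only [powMonoidHom_apply, Units.val_pow_eq_pow_val, Units.val_neg, Units.val_one] at this
  rw [← this, sq]

/-- From `p ≡ 3` modulo 4, `-1` is a nonsquare, so one of `d`, `-d` is a square; `p ≡ 2` modulo 3
gives the coprimality. -/
theorem isGoodSubgroup_unitSquares (hp : p % 12 = 11) :
    IsGoodSubgroup p (unitSquares p) ((p - 1) / 2) where
  card := card_unitSquares (by omega)
  coprime := by
    rw [Nat.Prime.coprime_iff_not_dvd Nat.prime_three]
    omega
  mem_or_neg_mem d := by
    have hi := index_unitSquares (p := p) (by omega)
    have h1 := neg_one_notMem_unitSquares (p := p) (by omega)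
    have := Subgroup.mul_mem_iff_of_index_two hi (a := -1) (b := d)
    rw [neg_one_mul] at this
    tauto

theorem isGoodSubgroup_top (hp : p % 3 = 2) : IsGoodSubgroup p ⊤ (p - 1) where
  card := by
    rw [Nat.card_congr Subgroup.topEquiv.toEquiv, Nat.card_eq_fintype_card, ZMod.card_units]
  coprime := by
    rw [Nat.Prime.coprime_iff_not_dvd Nat.prime_three]
    omega
  mem_or_neg_mem d := Or.inl trivial

theorem zpowers_sq_of_zpowers_eq_top {u : (ZMod p)ˣ} (hu : Subgroup.zpowers u = ⊤) :
    Subgroup.zpowers (u ^ 2) = unitSquares p := by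
  rw [unitSquares, MonoidHom.range_eq_map, ← hu, MonoidHom.map_zpowers]
  rfl

theorem notMem_unitSquares_of_zpowers_eq_top (hp : p ≠ 2) {u : (ZMod p)ˣ}
    (hu : Subgroup.zpowers u = ⊤) : u ∉ unitSquares p := by
  intro h
  have h2 := index_unitSquares hp
  rw [← Subgroup.zpowers_le, hu, top_le_iff] at h
  rw [h, Subgroup.index_top] at h2
  omega

/-- A generator `r` of a nontrivial `H` differs from `1`, so the congruence can be solved by `s =
-(r - 1)⁻¹`. -/
theorem exists_isParam {H : Subgroup (ZMod p)ˣ} (hH : Nat.card H ≠ 1) :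
    ∃ r s : ℤ, (0 ≤ r ∧ r < p) ∧ (0 ≤ s ∧ s < p) ∧ IsParam p H r s := by
  obtain ⟨u, hu⟩ := (Subgroup.isCyclic_iff_exists_zpowers_eq_top H).1 inferInstance
  have hu1 : (u : ZMod p) - 1 ≠ 0 := by
    intro h
    have : u = 1 := Units.ext (sub_eq_zero.1 h)
    rw [this, Subgroup.zpowers_one_eq_bot] at hu
    exact hH (by rw [← hu, Subgroup.card_bot])
  refine ⟨(u : ZMod p).val, (-((u : ZMod p) - 1)⁻¹).val, ⟨Int.natCast_nonneg _, ?_⟩,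
    ⟨Int.natCast_nonneg _, ?_⟩,
    ⟨u, by simp, hu⟩, ?_⟩
  · exact_mod_cast ZMod.val_lt _
  · exact_mod_cast ZMod.val_lt _
  · rw [← ZMod.intCast_eq_intCast_iff]
    push_cast
    rw [ZMod.natCast_zmod_val, ZMod.natCast_zmod_val, neg_mul, inv_mul_cancel₀ hu1]

end UnitSquares

/-! ### The cycle structure of the base of `h` -/

section HRelation

open Equiv Equiv.Perm

variable {p : ℕ}

/-- The point `e` is inserted into the cycle of `i` under multiplication by `v`: `π` runs through
`e, v i, v² i, …, i` and back to `e`, a cycle of length `orderOf v + 1`. -/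
theorem pow_apply_orbit {v i : (ZMod p)ˣ} {e : Bool} {π : Perm (ZMod p ⊕ Bool)}
    (he : π (.inr e) = .inl (v * i : (ZMod p)ˣ)) (hi : π (.inl i) = .inr e)
    (hw : ∀ w ∈ Subgroup.zpowers v, w ≠ 1 →
      π (.inl (w * i : (ZMod p)ˣ)) = .inl (v * (w * i) : (ZMod p)ˣ)) (hv : 0 < orderOf v) :
    (π ^ (orderOf v + 1)) (.inr e) = .inr e ∧
      ∀ w ∈ Subgroup.zpowers v, (π ^ (orderOf v + 1)) (.inl (w * i : (ZMod p)ˣ)) =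
        .inl (w * i : (ZMod p)ˣ) := by
  have key : ∀ k : ℕ, k < orderOf v →
      (π ^ (k + 1)) (.inr e) = .inl (v ^ (k + 1) * i : (ZMod p)ˣ) := by
    intro k
    induction k with
    | zero => intro _; simpa using he
    | succ k ih =>
      intro hk
      rw [pow_succ', Perm.mul_apply, ih (by omega), hw _ (Subgroup.npow_mem_zpowers v _)
        (pow_ne_one_of_lt_orderOf (by omega) hk), ← mul_assoc, ← pow_succ']
  have hend : (π ^ (orderOf v + 1)) (.inr e) = .inr e := by
    obtain ⟨m, hm⟩ := Nat.exists_eq_add_one.2 hv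
    rw [pow_succ', Perm.mul_apply, hm, key m (by omega), ← hm, pow_orderOf_eq_one, one_mul, hi]
  refine ⟨hend, fun w hwv => ?_⟩
  have : ∃ k, k < orderOf v ∧ v ^ (k + 1) = w := by
    have hfin : IsOfFinOrder v := orderOf_pos_iff.1 hv
    have hw' : w * v⁻¹ ∈ Subgroup.zpowers v :=
      Subgroup.mul_mem _ hwv (Subgroup.inv_mem _ (Subgroup.mem_zpowers v))
    rw [← hfin.mem_powers_iff_mem_zpowers, hfin.mem_powers_iff_mem_range_orderOf] at hw'
    simp only [Finset.mem_image, Finset.mem_range] at hw'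
    obtain ⟨k, hk, hkw⟩ := hw'
    exact ⟨k, hk, by rw [pow_succ, hkw, inv_mul_cancel_right]⟩
  obtain ⟨k, hk, rfl⟩ := this
  rw [← key k hk, ← Perm.mul_apply, ← pow_add, add_comm, pow_add, Perm.mul_apply, hend]

/-- If `v` generates a subgroup of index two not containing `j`, the product of the dilation by
`v` with two 3-cycles has two nontrivial cycles, of length `orderOf v + 1`. -/
theorem dilation_mul_threeCycle_pow [Fact p.Prime] {v j : (ZMod p)ˣ}
    (hindex : (Subgroup.zpowers v).index = 2) (hj : j ∉ Subgroup.zpowers v) :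
    (extendPerm _ (dilation p v) * threeCycle 1 * threeCycle (j : ZMod p)) ^ (orderOf v + 1) = 1 := by
  have hj1 : j ≠ 1 := by rintro rfl; exact hj (Subgroup.one_mem _)
  have hj1' : (1 : ZMod p) ≠ j := fun h => hj1 (Units.ext h.symm)
  -- The two transpositions insert `true` after `1` and `false` after `j`, one in each coset of
  -- `⟨v⟩`.
  rw [mul_assoc, threeCycle_mul hj1']
  set π := extendPerm _ (dilation p v) *
    (swap (.inl (1 : ZMod p)) (.inr true) * swap (.inl (j : ZMod p)) (.inr false)) with hπ
  have hother : ∀ w : (ZMod p)ˣ, w ≠ 1 → w ≠ j → π (.inl w) = .inl (v * w : (ZMod p)ˣ) := by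
    intro w h1 h2
    have h1' : (w : ZMod p) ≠ 1 := fun h => h1 (Units.ext h)
    have h2' : (w : ZMod p) ≠ j := fun h => h2 (Units.ext h)
    simp [hπ, Perm.mul_apply, swap_apply_def, h1', h2']
  have hpos : 0 < orderOf v := orderOf_pos v
  obtain ⟨t1, t2⟩ := pow_apply_orbit (π := π) (v := v) (i := 1) (e := true)
    (by simp [hπ, Perm.mul_apply, swap_apply_def])
    (by simp [hπ, Perm.mul_apply, swap_apply_def, hj1'])
    (fun w hw hw1 => by
      rw [mul_one]
      exact hother w hw1 (by rintro rfl; exact hj hw)) hpos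
  obtain ⟨f1, f2⟩ := pow_apply_orbit (π := π) (v := v) (i := j) (e := false)
    (by simp [hπ, Perm.mul_apply, swap_apply_def, hj1'.symm])
    (by simp [hπ, Perm.mul_apply, swap_apply_def])
    (fun w hw hw1 => hother _ (fun h => hj (by
      rw [← inv_eq_of_mul_eq_one_right h]; exact Subgroup.inv_mem _ hw))
      (fun h => hw1 (by simpa using h))) hpos
  ext1 x
  rw [Perm.one_apply]
  rcases x with x | _ | _
  · rcases eq_or_ne x 0 with rfl | hx
    · have h0 : π (.inl 0) = .inl 0 := by
        simp [hπ, Perm.mul_apply, swap_apply_def, j.ne_zero.symm]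
      exact Perm.pow_apply_eq_self_of_apply_eq_self h0 _
    · by_cases h : Units.mk0 x hx ∈ Subgroup.zpowers v
      · simpa using t2 _ h
      · have h' : Units.mk0 x hx * j⁻¹ ∈ Subgroup.zpowers v := by
          rw [Subgroup.mul_mem_iff_of_index_two hindex, Subgroup.inv_mem_iff]
          tauto
        simpa using f2 _ h'
  · exact f1
  · exact t1

end HRelation

/-! ### Bit-length estimates -/

section BitLength

variable {X : Type}

namespace PowExpr

theorem eval_surjective : Function.Surjective (eval (X := X)) := by
  intro w
  induction w using FreeGroup.induction_on with
  | C1 => exact ⟨one, rfl⟩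
  | of x => exact ⟨gen x, rfl⟩
  | inv_of x _ => exact ⟨pow (gen x) (-1), by simp [eval]⟩
  | mul v w hv hw =>
    obtain ⟨e, rfl⟩ := hv
    obtain ⟨f, rfl⟩ := hw
    exact ⟨mul e f, rfl⟩

end PowExpr

theorem wordBitLength_eval_le (e : PowExpr X) : wordBitLength e.eval ≤ e.size :=
  Nat.sInf_le ⟨e, rfl, rfl⟩

theorem exists_size_eq_wordBitLength (w : FreeGroup X) :
    ∃ e : PowExpr X, e.eval = w ∧ e.size = wordBitLength w := by
  obtain ⟨e, he⟩ := PowExpr.eval_surjective w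
  exact Nat.sInf_mem (s := {k | ∃ e : PowExpr X, e.eval = w ∧ e.size = k}) ⟨e.size, e, he, rfl⟩

theorem wordBitLength_of_le (x : X) : wordBitLength (FreeGroup.of x) ≤ 1 :=
  wordBitLength_eval_le (.gen x)

theorem wordBitLength_mul_le (v w : FreeGroup X) :
    wordBitLength (v * w) ≤ wordBitLength v + wordBitLength w := by
  obtain ⟨e, he, hv⟩ := exists_size_eq_wordBitLength v
  obtain ⟨f, hf, hw⟩ := exists_size_eq_wordBitLength w
  rw [← hv, ← hw, ← he, ← hf]
  exact wordBitLength_eval_le (.mul e f)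

/-- The range `2 * p` covers all exponents that occur, including `s - 1`. The 4 counts two
parentheses, the sign and one extra binary digit for the factor 2. -/
theorem wordBitLength_zpow_le (v : FreeGroup X) {n : ℤ} {p : ℕ}
    (hn : n.natAbs ≤ 2 * p) : wordBitLength (v ^ n) ≤ wordBitLength v + (Nat.size p + 4) := by
  obtain ⟨e, he, hv⟩ := exists_size_eq_wordBitLength v
  have h1 : max 1 (Nat.size n.natAbs) ≤ Nat.size p + 1 := by
    refine max_le (by omega) (Nat.size_le.2 ?_)
    have := Nat.lt_size_self p
    rw [pow_succ]
    omega
  have h2 := wordBitLength_eval_le (.pow e n)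
  simp only [PowExpr.eval, PowExpr.size, he] at h2
  omega

theorem wordBitLength_pow_le (v : FreeGroup X) {n p : ℕ} (hn : n ≤ 2 * p) :
    wordBitLength (v ^ n) ≤ wordBitLength v + (Nat.size p + 4) := by
  have := wordBitLength_zpow_le v (n := n) (by simpa using hn)
  rwa [zpow_natCast] at this

theorem wordBitLength_inv_le (v : FreeGroup X) {p : ℕ} (hp : 0 < p) :
    wordBitLength v⁻¹ ≤ wordBitLength v + (Nat.size p + 4) := by
  have := wordBitLength_zpow_le v (n := -1) (p := p) (by simp; omega)
  rwa [zpow_neg_one] at this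

theorem wordBitLength_conjBy_le (v w : FreeGroup X) {p : ℕ} (hp : 0 < p) :
    wordBitLength (conjBy v w) ≤ wordBitLength v + 2 * wordBitLength w + (Nat.size p + 4) := by
  have h1 := wordBitLength_mul_le (w⁻¹ * v) w
  have h2 := wordBitLength_mul_le w⁻¹ v
  have h3 := wordBitLength_inv_le w hp
  rw [conjBy]
  omega

/-- For `size p = k + 1` one has `k * log 2 ≤ log p` with `log 2 > 1/2`; the remaining `1` is
absorbed by `log p ≥ 1`, which needs `p ≥ 3`. -/
theorem natSize_le_log {p : ℕ} (hp : 3 ≤ p) : (Nat.size p : ℝ) ≤ 3 * Real.log p := by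
  have hlog : 1 ≤ Real.log p := by
    rw [Real.le_log_iff_exp_le (by positivity)]
    have : (3 : ℝ) ≤ p := by exact_mod_cast hp
    linarith [Real.exp_one_lt_d9]
  obtain ⟨k, hk⟩ : ∃ k, Nat.size p = k + 1 :=
    Nat.exists_eq_add_one.2 (Nat.size_pos.2 (by omega))
  have h2 : 2 ^ k ≤ p := Nat.lt_size.1 (by omega)
  have h3 : k * Real.log 2 ≤ Real.log p := by
    rw [← Real.log_pow]
    exact Real.log_le_log (by positivity) (by exact_mod_cast h2)
  have h4 := Real.log_two_gt_d9
  have h5 : (k : ℝ) * 0.5 ≤ k * Real.log 2 :=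
    mul_le_mul_of_nonneg_left (by linarith) (Nat.cast_nonneg k)
  rw [hk]
  push_cast
  linarith

section Relators

variable {p κ : ℕ}

theorem wordBitLength_wordB_le (hp : 2 ≤ p) : wordBitLength wordB ≤ Nat.size p + 5 := by
  have h1 := wordBitLength_pow_le genG (n := 3) (p := p) (by omega)
  have h2 := wordBitLength_of_le (1 : Fin 2)
  rw [wordB]
  rw [← genG] at h2
  omega

theorem wordBitLength_wordZ_le (hp : 2 ≤ p) (hκ : κ ≤ p) :
    wordBitLength (wordZ κ) ≤ Nat.size p + 5 := by
  have h1 := wordBitLength_pow_le genG (n := κ) (p := p) (by omega)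
  have h2 := wordBitLength_of_le (1 : Fin 2)
  rw [wordZ]
  rw [← genG] at h2
  omega

theorem wordBitLength_genA_le : wordBitLength genA ≤ 1 := wordBitLength_of_le 0

theorem wordBitLength_relPower_le (hp : 2 ≤ p) (hκ : κ ≤ p) :
    wordBitLength (relPower p κ) ≤ 4 * Nat.size p + 18 := by
  have h0 := wordBitLength_genA_le
  have h1 := wordBitLength_mul_le (genA ^ p) (wordB ^ κ)⁻¹
  have h2 := wordBitLength_pow_le genA (n := p) (p := p) (by omega)
  have h3 := wordBitLength_inv_le (wordB ^ κ) (p := p) (by omega)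
  have h4 := wordBitLength_pow_le wordB (n := κ) (p := p) (by omega)
  have h5 := wordBitLength_wordB_le hp
  rw [relPower]
  omega

theorem wordBitLength_relConj_le (hp : 2 ≤ p) {s : ℤ} (hs : |s| ≤ p) :
    wordBitLength (relConj s) ≤ 6 * Nat.size p + 28 := by
  rw [abs_le] at hs
  have h0 := wordBitLength_genA_le
  have h1 := wordBitLength_mul_le (conjBy (genA ^ s) wordB) (genA ^ (s - 1))⁻¹
  have h2 := wordBitLength_conjBy_le (genA ^ s) wordB (p := p) (by omega)
  have h3 := wordBitLength_zpow_le genA (n := s) (p := p) (by omega)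
  have h4 := wordBitLength_inv_le (genA ^ (s - 1)) (p := p) (by omega)
  have h5 := wordBitLength_zpow_le genA (n := s - 1) (p := p) (by omega)
  have h6 := wordBitLength_wordB_le hp
  rw [relConj]
  omega

theorem wordBitLength_relZ_le (hp : 2 ≤ p) (hκ : κ ≤ p) :
    wordBitLength (relZ κ) ≤ 4 * Nat.size p + 20 := by
  have h0 := wordBitLength_genA_le
  have h1 := wordBitLength_pow_le (wordZ κ * conjBy (wordZ κ) genA) (n := 2) (p := p)
    (by omega)
  have h2 := wordBitLength_mul_le (wordZ κ) (conjBy (wordZ κ) genA)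
  have h3 := wordBitLength_conjBy_le (wordZ κ) genA (p := p) (by omega)
  have h4 := wordBitLength_wordZ_le hp hκ
  rw [relZ]
  omega

theorem wordBitLength_hAlt_le (hp : 2 ≤ p) (hκ : κ ≤ p) :
    wordBitLength (hAlt p κ) ≤ 10 * Nat.size p + 50 := by
  have h0 := wordBitLength_genA_le
  have h1 := wordBitLength_pow_le (wordB * conjBy (wordZ κ) genA * conjBy (wordZ κ) genA⁻¹)
    (n := (p + 1) / 2) (p := p) (by omega)
  have h2 := wordBitLength_mul_le (wordB * conjBy (wordZ κ) genA) (conjBy (wordZ κ) genA⁻¹)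
  have h3 := wordBitLength_mul_le wordB (conjBy (wordZ κ) genA)
  have h4 := wordBitLength_conjBy_le (wordZ κ) genA (p := p) (by omega)
  have h5 := wordBitLength_conjBy_le (wordZ κ) genA⁻¹ (p := p) (by omega)
  have h6 := wordBitLength_inv_le genA (p := p) (by omega)
  have h7 := wordBitLength_wordZ_le hp hκ
  have h8 := wordBitLength_wordB_le hp
  rw [hAlt]
  omega

theorem wordBitLength_hSym_le (hp : 2 ≤ p) (hκ : κ ≤ p) {r : ℤ} (hr : |r| ≤ p) :
    wordBitLength (hSym p κ r) ≤ 10 * Nat.size p + 50 := by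
  rw [abs_le] at hr
  have h0 := wordBitLength_genA_le
  have h1 := wordBitLength_pow_le
    (wordB ^ 2 * conjBy (wordZ κ) genA * conjBy (wordZ κ) (genA ^ r))
    (n := (p + 1) / 2) (p := p) (by omega)
  have h2 := wordBitLength_mul_le (wordB ^ 2 * conjBy (wordZ κ) genA)
    (conjBy (wordZ κ) (genA ^ r))
  have h3 := wordBitLength_mul_le (wordB ^ 2) (conjBy (wordZ κ) genA)
  have h4 := wordBitLength_conjBy_le (wordZ κ) genA (p := p) (by omega)
  have h5 := wordBitLength_conjBy_le (wordZ κ) (genA ^ r) (p := p) (by omega)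
  have h6 := wordBitLength_zpow_le genA (n := r) (p := p) (by omega)
  have h7 := wordBitLength_wordZ_le hp hκ
  have h8 := wordBitLength_wordB_le hp
  have h9 := wordBitLength_pow_le wordB (n := 2) (p := p) (by omega)
  rw [hSym]
  omega

theorem bitLength_presJHat_le (hp : 3 ≤ p) (hκ : κ ≤ p) {s : ℤ} (hs : |s| ≤ p) :
    ((presJHat p κ s).bitLength : ℝ) ≤ 500 * Real.log p := by
  have h1 := wordBitLength_relPower_le (by omega) hκ
  have h2 := wordBitLength_relConj_le (by omega) hs
  have h3 := wordBitLength_relZ_le (by omega) hκ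
  have hsize : 0 < Nat.size p := Nat.size_pos.2 (by omega)
  have h : (presJHat p κ s).bitLength ≤ 100 * Nat.size p := by
    simp only [FinPresentation.bitLength, presJHat, Fin.sum_univ_three, Matrix.cons_val]
    omega
  have h' : ((presJHat p κ s).bitLength : ℝ) ≤ 100 * Nat.size p := by exact_mod_cast h
  have hlog := Real.log_nonneg (x := p) (by exact_mod_cast (by omega : 1 ≤ p))
  linarith [natSize_le_log hp]

theorem bitLength_presJ_le (hp : 3 ≤ p) (hκ : κ ≤ p) {s : ℤ} (hs : |s| ≤ p)
    {h : FreeGroup (Fin 2)} (hh : wordBitLength h ≤ 10 * Nat.size p + 50) :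
    ((presJ p κ s h).bitLength : ℝ) ≤ 500 * Real.log p := by
  have h1 := wordBitLength_relPower_le (by omega) hκ
  have h2 := wordBitLength_relConj_le (by omega) hs
  have h3 := wordBitLength_relZ_le (by omega) hκ
  have hsize : 1 < Nat.size p := Nat.lt_size.2 (by omega)
  have hle : (presJ p κ s h).bitLength ≤ 150 * Nat.size p := by
    simp only [FinPresentation.bitLength, presJ, Fin.sum_univ_four, Matrix.cons_val]
    omega
  have h' : ((presJ p κ s h).bitLength : ℝ) ≤ 150 * Nat.size p := by exact_mod_cast hle
  linarith [natSize_le_log hp, Real.log_nonneg (x := p) (by exact_mod_cast (by omega : 1 ≤ p))]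

end Relators

end BitLength

/-! ### Homomorphisms from the presented groups -/

section Presentations

namespace FinPresentation

variable {m : ℕ} (P : FinPresentation 2 m)

theorem closure_generators_eq_top :
    Subgroup.closure {(PresentedGroup.of 0 : P.toGroup), PresentedGroup.of 1} = ⊤ := by
  rw [← PresentedGroup.closure_range_of (Set.range P.rel)]
  congr 1
  ext x
  simp [Fin.exists_fin_two, eq_comm]

theorem lift_generators_rel (i : Fin m) :
    FreeGroup.lift ![(PresentedGroup.of 0 : P.toGroup), PresentedGroup.of 1] (P.rel i) = 1 := by
  have h : FreeGroup.lift ![(PresentedGroup.of 0 : P.toGroup), PresentedGroup.of 1] =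
      PresentedGroup.mk (Set.range P.rel) := by
    ext j
    fin_cases j <;> simp [PresentedGroup.of]
  rw [h]
  exact PresentedGroup.one_of_mem ⟨i, rfl⟩

/-- A presented group is isomorphic to a subgroup generated by elements satisfying the relations,
as soon as its order is at most the order of the subgroup. -/
theorem nonempty_mulEquiv_of_card_le {P : FinPresentation 2 m} {K : Type} [Group K] {a g : K}
    (hrel : ∀ i, FreeGroup.lift ![a, g] (P.rel i) = 1) {E : Subgroup K}
    (hE : Subgroup.closure {a, g} = E) [Finite P.toGroup]
    (hcard : Nat.card P.toGroup ≤ Nat.card E) : Nonempty (P.toGroup ≃* E) := by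
  have hrel' : ∀ r ∈ Set.range P.rel, FreeGroup.lift ![a, g] r = 1 := by
    rintro _ ⟨i, rfl⟩
    exact hrel i
  let F : P.toGroup →* K := PresentedGroup.toGroup hrel'
  have hrange : F.range = E := by
    rw [← hE, MonoidHom.range_eq_map, ← closure_generators_eq_top, MonoidHom.map_closure,
      Set.image_pair]
    simp [F]
  have hsurj : Function.Surjective F.rangeRestrict := F.rangeRestrict_surjective
  have hbij := hsurj.bijective_of_nat_card_le (by rw [hrange]; exact hcard)
  exact ⟨(MulEquiv.ofBijective _ hbij).trans (MulEquiv.subgroupCongr hrange)⟩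

end FinPresentation

section Lift

variable {G : Type*} [Group G] (a g : G) {p κ : ℕ} {r s : ℤ}

theorem lift_relPower_eq_one :
    FreeGroup.lift ![a, g] (relPower p κ) = 1 ↔ a ^ p = (g ^ 3) ^ κ := by
  simp [relPower, genA, wordB, genG, mul_inv_eq_one]

theorem lift_relConj_eq_one :
    FreeGroup.lift ![a, g] (relConj s) = 1 ↔ conjBy (a ^ s) (g ^ 3) = a ^ (s - 1) := by
  simp only [relConj, conjBy, genA, wordB, genG, map_mul, map_inv, map_zpow, map_pow,
    FreeGroup.lift_apply_of, mul_inv_eq_one]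
  rfl

theorem lift_relZ :
    FreeGroup.lift ![a, g] (relZ κ) = (g ^ κ * conjBy (g ^ κ) a) ^ 2 := by
  simp [relZ, conjBy, genA, wordZ, genG]

theorem lift_hAlt : FreeGroup.lift ![a, g] (hAlt p κ) =
    (g ^ 3 * conjBy (g ^ κ) a * conjBy (g ^ κ) a⁻¹) ^ ((p + 1) / 2) := by
  simp [hAlt, conjBy, genA, wordZ, genG, wordB]

theorem lift_hSym : FreeGroup.lift ![a, g] (hSym p κ r) =
    ((g ^ 3) ^ 2 * conjBy (g ^ κ) a * conjBy (g ^ κ) (a ^ r)) ^ ((p + 1) / 2) := by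
  simp [hSym, conjBy, genA, wordZ, genG, wordB]

theorem lift_presJHat_rel : (∀ i, FreeGroup.lift ![a, g] ((presJHat p κ s).rel i) = 1) ↔
    a ^ p = (g ^ 3) ^ κ ∧ conjBy (a ^ s) (g ^ 3) = a ^ (s - 1) ∧
      (g ^ κ * conjBy (g ^ κ) a) ^ 2 = 1 := by
  rw [← lift_relPower_eq_one, ← lift_relConj_eq_one, ← lift_relZ]
  simp [presJHat, Fin.forall_fin_succ]

theorem lift_presJ_rel {h : FreeGroup (Fin 2)} :
    (∀ i, FreeGroup.lift ![a, g] ((presJ p κ s h).rel i) = 1) ↔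
    a ^ p = (g ^ 3) ^ κ ∧ conjBy (a ^ s) (g ^ 3) = a ^ (s - 1) ∧
      (g ^ κ * conjBy (g ^ κ) a) ^ 2 = 1 ∧ FreeGroup.lift ![a, g] h = 1 := by
  rw [← lift_relPower_eq_one, ← lift_relConj_eq_one, ← lift_relZ]
  simp [presJ, Fin.forall_fin_succ]

end Lift

end Presentations

/-! ### The subgroup of pairs of equal sign -/

section EvenSubgroup

open Equiv Equiv.Perm

variable {p : ℕ} [Fact p.Prime] {T : Subgroup (Perm (ZMod p))}

theorem evenSubgroup_eq_ker :
    evenSubgroup p T = ((sign : Perm (Fin (p + 2) ⊕ ZMod p) →* ℤˣ).comp (disjointAction p T)).ker :=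
  rfl

theorem sign_disjointAction (q : Perm (Fin (p + 2)) × T) :
    sign (disjointAction p T q) = sign q.1 * sign (q.2 : Perm (ZMod p)) :=
  sign_sumCongr _ _

theorem mem_evenSubgroup {q : Perm (Fin (p + 2)) × T} :
    q ∈ evenSubgroup p T ↔ sign q.1 = sign (q.2 : Perm (ZMod p)) := by
  rw [evenSubgroup_eq_ker, MonoidHom.mem_ker, MonoidHom.comp_apply, sign_disjointAction,
    mul_eq_one_iff_eq_inv, Int.units_inv_eq_self]

theorem index_evenSubgroup : (evenSubgroup p T).index = 2 := by
  rw [evenSubgroup_eq_ker, Subgroup.index_ker, MonoidHom.range_eq_top.2]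
  · rw [Nat.card_congr Subgroup.topEquiv.toEquiv]
    simp
  · intro ε
    rcases Int.units_eq_one_or ε with rfl | rfl
    · exact ⟨1, map_one _⟩
    · refine ⟨(swap 0 1, 1), ?_⟩
      rw [MonoidHom.comp_apply, sign_disjointAction]
      simp

theorem eq_evenSubgroup_of_index_two {H : Subgroup (Perm (Fin (p + 2)) × T)} (hH : H.index = 2)
    (hle : H.map (disjointAction p T) ≤ alternatingGroup (Fin (p + 2) ⊕ ZMod p)) :
    H = evenSubgroup p T := by
  have hle' : H ≤ evenSubgroup p T := Subgroup.map_le_iff_le_comap.1 hle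
  refine le_antisymm hle' (Subgroup.relIndex_eq_one.1 ?_)
  have := Subgroup.relIndex_mul_index hle'
  rw [hH, index_evenSubgroup] at this
  omega

theorem two_mul_card_evenSubgroup :
    2 * Nat.card (evenSubgroup p T) = (p + 2).factorial * Nat.card T := by
  have := (evenSubgroup p T).card_mul_index
  rw [index_evenSubgroup, Nat.card_prod, Nat.card_perm, Nat.card_fin] at this
  rw [mul_comm, this]

theorem evenSubgroup_AGL1Sq (hp : p ≠ 2) :
    evenSubgroup p (AGL1Sq p) = (alternatingGroup (Fin (p + 2))).prod ⊤ := by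
  ext q
  rw [mem_evenSubgroup, sign_eq_one_of_mem_AGL1Sq hp q.2.2, Subgroup.mem_prod]
  simp

end EvenSubgroup

/-! ### Permutations satisfying the relations -/

section Realization

open Equiv Equiv.Perm

variable {p : ℕ} {H : Subgroup (ZMod p)ˣ}

/-- The action of the affine group on `ZMod p` together with two fixed points, paired with the
identity. -/
def affineDiagonal (p : ℕ) (H : Subgroup (ZMod p)ˣ) :
    affineSubgroup p H →* Perm (ZMod p ⊕ Bool) × affineSubgroup p H :=
  ((extendPerm (ZMod p)).comp (affineSubgroup p H).subtype).prod (MonoidHom.id _)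

theorem conjBy_threeCycle (t : affineSubgroup p H) :
    conjBy ((threeCycle (0 : ZMod p), 1) : _ × affineSubgroup p H) (affineDiagonal p H t) =
      (threeCycle ((t : Perm (ZMod p))⁻¹ 0), 1) := by
  refine Prod.ext ?_ ?_
  · have := extendPerm_conj_threeCycle (t : Perm (ZMod p))⁻¹ 0
    rw [map_inv, inv_inv] at this
    exact this
  · simp [conjBy]

/-- Conversely to `closure_pow_coprime`, commuting `b` and `z` are combined into one `g = b ^ x * z
^ y`, where `3 * x + k * y = 1`. -/
theorem exists_pow_three_eq {G : Type*} [Group G] {b z : G} {k : ℕ} (hk : Nat.Coprime 3 k)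
    (hbz : Commute b z) (hb : b ^ k = 1) (hz : z ^ 3 = 1) : ∃ g : G, g ^ 3 = b ∧ g ^ k = z := by
  have hbez := Nat.gcd_eq_gcd_ab 3 k
  rw [hk.gcd_eq_one] at hbez
  push_cast at hbez
  set x := Nat.gcdA 3 k
  set y := Nat.gcdB 3 k
  have hcomm : Commute (b ^ x) (z ^ y) := (hbz.zpow_left x).zpow_right y
  have hb' : b ^ (k : ℤ) = 1 := by rw [zpow_natCast, hb]
  have hz' : z ^ (3 : ℤ) = 1 := by exact_mod_cast hz
  refine ⟨b ^ x * z ^ y, ?_, ?_⟩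
  · rw [hcomm.mul_pow, ← zpow_natCast, ← zpow_natCast, ← zpow_mul, ← zpow_mul]
    rw [mul_comm y, zpow_mul z, Nat.cast_ofNat, hz', one_zpow, mul_one,
      show x * 3 = 1 - k * y by linarith, zpow_sub, zpow_mul, hb']
    simp
  · rw [hcomm.mul_pow, ← zpow_natCast, ← zpow_natCast, ← zpow_mul, ← zpow_mul]
    rw [mul_comm x, zpow_mul b, hb', one_zpow, one_mul,
      show y * k = 1 - 3 * x by linarith, zpow_sub, zpow_mul, hz']
    simp

variable [Fact p.Prime]

/-- The standard generators satisfy the relations of `presJHat` and generate the group of pairs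
of permutations of the same sign. -/
theorem exists_realization {κ : ℕ} (hgood : IsGoodSubgroup p H κ) {u : (ZMod p)ˣ}
    (hu : u ∈ H) (huH : Subgroup.zpowers u = H) {s : ℤ} (hs : (u : ZMod p) * s = s - 1) :
    ∃ g : Perm (ZMod p ⊕ Bool) × affineSubgroup p H,
      g ^ 3 = affineDiagonal p H (affineB hu) ∧ g ^ κ = (threeCycle 0, 1) ∧
      affineDiagonal p H (affineA p H) ^ p = (g ^ 3) ^ κ ∧
      conjBy (affineDiagonal p H (affineA p H) ^ s) (g ^ 3) =
        affineDiagonal p H (affineA p H) ^ (s - 1) ∧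
      (g ^ κ * conjBy (g ^ κ) (affineDiagonal p H (affineA p H))) ^ 2 = 1 ∧
      ∀ q, q ∈ Subgroup.closure {affineDiagonal p H (affineA p H), g} ↔
        sign q.1 = sign (q.2 : Perm (ZMod p)) := by
  set A := affineDiagonal p H (affineA p H) with hA
  set B := affineDiagonal p H (affineB hu) with hB
  set Z : Perm (ZMod p ⊕ Bool) × affineSubgroup p H := (threeCycle 0, 1) with hZ
  -- The dilation fixes `0` and the added points, which are the points moved by the 3-cycle.
  have hBZ : Commute B Z := by
    have h := conjBy_threeCycle (affineB hu)
    have h0 : ((affineB hu : affineSubgroup p H) : Perm (ZMod p))⁻¹ 0 = 0 := by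
      rw [Perm.inv_eq_iff_eq, affineB, dilation_apply, mul_zero]
    rw [h0, ← hZ, ← hB, conjBy, mul_assoc, inv_mul_eq_iff_eq_mul] at h
    exact h.symm
  have hBκ : B ^ κ = 1 := by rw [hB, ← map_pow, ← hgood.card, affineB_pow_eq_one, map_one]
  have hZ3 : Z ^ 3 = 1 := Prod.ext (threeCycle_pow_three _) (one_pow _)
  obtain ⟨g, hg3, hgκ⟩ := exists_pow_three_eq hgood.coprime hBZ hBκ hZ3
  refine ⟨g, hg3, hgκ, ?_, ?_, ?_, ?_⟩
  · rw [hg3, hBκ, hA, ← map_pow, affineA_pow_eq_one, map_one]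
  · have := congrArg (affineDiagonal p H) (affine_conj hu hs)
    simpa only [hg3, conjBy, map_mul, map_inv, map_zpow] using this
  · rw [hgκ, hA, hZ, conjBy_threeCycle]
    refine Prod.ext ?_ (by simp)
    apply threeCycle_mul_sq
    intro h
    have h' := congrArg (affineA p H : Perm (ZMod p)) h
    simp [affineA] at h'
  · rw [← closure_pow_coprime hgood.coprime, hg3, hgκ]
    set M := Subgroup.closure {A, B, Z} with hM
    have hdiag : ∀ t, affineDiagonal p H t ∈ M := by
      have : (⊤ : Subgroup (affineSubgroup p H)) ≤ M.comap (affineDiagonal p H) := by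
        rw [← affineSubgroup_closure hu huH, Subgroup.closure_le]
        rintro t (rfl | rfl)
        · exact Subgroup.subset_closure (by simp [hA])
        · exact Subgroup.subset_closure (by simp [hB])
      exact fun t => this (Subgroup.mem_top t)
    have hZM : Z ∈ M := Subgroup.subset_closure (by simp)
    -- Conjugating `Z` by diagonal elements moves its 3-cycle to every `i` and keeps the second
    -- coordinate trivial, so `M` contains the alternating group times `1`.
    have hcyc : ∀ σ : Perm (ZMod p ⊕ Bool), sign σ = 1 →
        ((σ, 1) : _ × affineSubgroup p H) ∈ M := by
      have : Subgroup.closure (Set.range (threeCycle (α := ZMod p))) ≤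
          M.comap (MonoidHom.inl _ _) := by
        rw [Subgroup.closure_le]
        rintro _ ⟨i, rfl⟩
        let t : affineSubgroup p H := ⟨Equiv.addRight (-i), addRight_mem_affineSubgroup _⟩
        have h := conjBy_threeCycle t
        have h0 : (t : Perm (ZMod p))⁻¹ 0 = i := by
          rw [Perm.inv_eq_iff_eq]
          simp [t]
        rw [h0] at h
        have hmem : conjBy Z (affineDiagonal p H t) ∈ M :=
          M.mul_mem (M.mul_mem (M.inv_mem (hdiag t)) hZM) (hdiag t)
        rw [h] at hmem
        exact hmem
      exact fun σ hσ => this (mem_closure_threeCycle hσ)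
    have hsign : ∀ t, sign (affineDiagonal p H t).1 = sign (t : Perm (ZMod p)) := fun t =>
      sign_extendPerm _
    intro q
    constructor
    · intro hq
      have hle : M ≤ MonoidHom.eqLocus ((sign : Perm (ZMod p ⊕ Bool) →* ℤˣ).comp (MonoidHom.fst _ _))
          ((sign.comp (affineSubgroup p H).subtype).comp (MonoidHom.snd _ _)) := by
        rw [hM, Subgroup.closure_le]
        rintro _ (rfl | rfl | rfl)
        · exact hsign _
        · exact hsign _
        · change sign (threeCycle (0 : ZMod p)) = sign (1 : Perm (ZMod p))
          rw [sign_threeCycle, Perm.sign_one]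
      exact hle hq
    · intro hq
      -- Dividing by the diagonal element over `q.2` leaves an even permutation in the first
      -- coordinate and `1` in the second.
      have h1 : (q.1 * (affineDiagonal p H q.2).1⁻¹, 1) ∈ M := hcyc _ (by
        rw [Perm.sign_mul, Perm.sign_inv, hsign, hq, Int.units_mul_self])
      have h2 := M.mul_mem h1 (hdiag q.2)
      have h3 : (q.1 * (affineDiagonal p H q.2).1⁻¹, 1) * affineDiagonal p H q.2 = q :=
        Prod.ext (by simp) (by simp [affineDiagonal])
      rwa [h3] at h2

end Realization

/-! ### The isomorphisms -/

section Isomorphisms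

open Equiv Equiv.Perm

theorem lift_map_apply {G K : Type*} [Group G] [Group K] (f : G →* K) (a g : G)
    (w : FreeGroup (Fin 2)) :
    FreeGroup.lift ![f a, f g] w = f (FreeGroup.lift ![a, g] w) := by
  have : FreeGroup.lift ![f a, f g] = f.comp (FreeGroup.lift ![a, g]) := by
    ext j
    fin_cases j <;> simp
  rw [this]
  rfl

/-- Applied to `h`: modulo a normal subgroup containing `z`, the conjugates of `z` vanish and only a
power of `b` survives. -/
theorem Subgroup.pow_mem_of_mul_mul_pow_eq_one {G : Type*} [Group G] {N : Subgroup G} (hN : N.Normal)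
    {c x y : G} (hx : x ∈ N) (hy : y ∈ N) {q : ℕ} (h : (c * x * y) ^ q = 1) : c ^ q ∈ N := by
  have h' := congrArg (QuotientGroup.mk' N) h
  have hx' : QuotientGroup.mk' N x = 1 := (QuotientGroup.eq_one_iff _).2 hx
  have hy' : QuotientGroup.mk' N y = 1 := (QuotientGroup.eq_one_iff _).2 hy
  rw [map_pow, map_mul, map_mul, hx', hy', mul_one, mul_one, ← map_pow, map_one] at h'
  exact (QuotientGroup.eq_one_iff _).1 h'

theorem Subgroup.conjBy_mem {G : Type*} [Group G] {N : Subgroup G} (hN : N.Normal) {x : G}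
    (hx : x ∈ N) (y : G) : conjBy x y ∈ N := by
  simpa [conjBy] using hN.conj_mem x hx y⁻¹

variable {p : ℕ} [Fact p.Prime] {H : Subgroup (ZMod p)ˣ} {κ : ℕ} {r s : ℤ}

theorem IsParam.mul_eq {u : (ZMod p)ˣ} (hu : (u : ZMod p) = r) (hs : s * (r - 1) ≡ -1 [ZMOD (p : ℤ)]) :
    (u : ZMod p) * s = s - 1 := by
  have := (ZMod.intCast_eq_intCast_iff _ _ _).2 hs
  push_cast at this
  rw [hu]
  linear_combination this

/-- A labelling of the `p + 2` points. -/
noncomputable def pointsEquiv (p : ℕ) [Fact p.Prime] : ZMod p ⊕ Bool ≃ Fin (p + 2) :=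
  Fintype.equivOfCardEq (by simp [ZMod.card])

theorem IsGoodSubgroup.pos (hgood : IsGoodSubgroup p H κ) : 0 < κ :=
  hgood.card ▸ Nat.card_pos

theorem nonempty_presJHat_equiv (hgood : IsGoodSubgroup p H κ) (hrs : IsParam p H r s) :
    Nonempty ((presJHat p κ s).toGroup ≃* evenSubgroup p (affineSubgroup p H)) := by
  obtain ⟨⟨u, hur, huH⟩, hs⟩ := id hrs
  have hu : u ∈ H := huH ▸ Subgroup.mem_zpowers u
  obtain ⟨g, -, -, h1, h2, h3, hmem⟩ := exists_realization hgood hu huH (IsParam.mul_eq hur hs)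
  set A := affineDiagonal p H (affineA p H)
  let φ : (Perm (ZMod p ⊕ Bool) × affineSubgroup p H) ≃*
      (Perm (Fin (p + 2)) × affineSubgroup p H) :=
    MulEquiv.prodCongr (pointsEquiv p).permCongrHom (MulEquiv.refl _)
  obtain ⟨k1, k2, k3⟩ := (lift_presJHat_rel _ _).1 (presJHat p κ s).lift_generators_rel
  obtain ⟨hfin, hcard⟩ := card_le_of_relations hgood hgood.pos hrs
    (presJHat p κ s).closure_generators_eq_top k1 k2 k3
  refine FinPresentation.nonempty_mulEquiv_of_card_le (a := φ A) (g := φ g) (fun i => ?_) ?_ ?_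
  · have := lift_map_apply φ.toMonoidHom A g ((presJHat p κ s).rel i)
    rw [(lift_presJHat_rel A g).2 ⟨h1, h2, h3⟩ i, map_one] at this
    exact this
  · have : Subgroup.closure {φ A, φ g} = (Subgroup.closure {A, g}).map φ.toMonoidHom := by
      rw [MonoidHom.map_closure, Set.image_pair]
      rfl
    rw [this]
    ext q
    rw [Subgroup.mem_map_equiv, hmem, mem_evenSubgroup]
    have hq : sign (φ.symm q).1 = sign q.1 := sign_permCongr (pointsEquiv p).symm q.1
    rw [hq]
    rfl
  · have h4 := two_mul_card_evenSubgroup (p := p) (T := affineSubgroup p H)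
    have h5 := Nat.mul_le_mul (le_refl (p + 2).factorial) (card_affineSubgroup_ge (H := H))
    rw [hgood.card] at h5
    -- Twice the presented order is at most `(p + 2)! * (p * κ)`, hence at most `(p + 2)! * |T|`,
    -- which is twice the order of the even subgroup.
    exact Nat.le_of_mul_le_mul_left (hcard.trans (h5.trans h4.ge)) two_pos

/-- If the word `h` evaluates to `1` in the natural permutation group, and its vanishing bounds the
affine quotient suitably, the group `presJ` is the natural permutation group. -/
theorem nonempty_presJ_equiv (hgood : IsGoodSubgroup p H κ) (hrs : IsParam p H r s)
    {h : FreeGroup (Fin 2)} {m : ℕ} (hm : 0 < m) (hrm : (r : ZMod p) ^ m ≠ 1)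
    (hbm : ∀ (G : Type) [Group G] (a g : G), FreeGroup.lift ![a, g] h = 1 → (g ^ 3) ^ κ = 1 →
      ∀ N : Subgroup G, N.Normal → g ^ κ ∈ N → (g ^ 3) ^ m ∈ N)
    (hh : ∀ (u : (ZMod p)ˣ) (hu : u ∈ H), (u : ZMod p) = r →
      Subgroup.zpowers u = H → ∀ g, g ^ 3 = affineDiagonal p H (affineB hu) →
      g ^ κ = (threeCycle 0, 1) →
      (FreeGroup.lift ![affineDiagonal p H (affineA p H), g] h).1 = 1)
    {E : Subgroup (Perm (Fin (p + 2)))}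
    (hE : ∀ σ, σ ∈ E ↔ ∃ t : affineSubgroup p H, sign (t : Perm (ZMod p)) = sign σ)
    (hcardE : (p + 2).factorial * m ≤ 2 * Nat.card E) :
    Nonempty ((presJ p κ s h).toGroup ≃* E) := by
  obtain ⟨⟨u, hur, huH⟩, hs⟩ := id hrs
  have hu : u ∈ H := huH ▸ Subgroup.mem_zpowers u
  obtain ⟨g, hg3, hgκ, h1, h2, h3, hmem⟩ :=
    exists_realization hgood hu huH (IsParam.mul_eq hur hs)
  have h4 := hh u hu hur huH g hg3 hgκ
  set A := affineDiagonal p H (affineA p H)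
  -- The affine coordinate is dropped, since `h` is only required to be trivial in the first one.
  let φ : (Perm (ZMod p ⊕ Bool) × affineSubgroup p H) →* Perm (Fin (p + 2)) :=
    (pointsEquiv p).permCongrHom.toMonoidHom.comp (MonoidHom.fst _ _)
  obtain ⟨k1, k2, k3, k4⟩ := (lift_presJ_rel _ _).1 (presJ p κ s h).lift_generators_rel
  obtain ⟨hfin, hcard⟩ := card_le_of_relations_of_pow hgood hrs
    (presJ p κ s h).closure_generators_eq_top k1 k2 k3 hm hrm (hbm _ _ _ k4)
  refine FinPresentation.nonempty_mulEquiv_of_card_le (a := φ A) (g := φ g) ?_ ?_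
    (Nat.le_of_mul_le_mul_left (hcard.trans hcardE) two_pos)
  · rw [lift_presJ_rel, lift_map_apply]
    refine ⟨?_, ?_, ?_, ?_⟩
    · simpa only [map_pow] using congrArg φ h1
    · simpa only [conjBy, map_mul, map_inv, map_pow, map_zpow] using congrArg φ h2
    · simpa [conjBy] using congrArg φ h3
    · have : φ (FreeGroup.lift ![A, g] h) = (pointsEquiv p).permCongrHom
        (FreeGroup.lift ![A, g] h).1 := rfl
      rw [this, h4, map_one]
  · rw [← Set.image_pair, ← MonoidHom.map_closure]
    ext σ
    rw [hE, Subgroup.mem_map]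
    constructor
    · rintro ⟨q, hq, rfl⟩
      refine ⟨q.2, ((hmem q).1 hq).symm.trans ?_⟩
      exact (sign_permCongr (pointsEquiv p) q.1).symm
    · rintro ⟨t, ht⟩
      refine ⟨((pointsEquiv p).permCongrHom.symm σ, t), (hmem _).2 ?_, ?_⟩
      · rw [ht]
        exact sign_permCongr (pointsEquiv p).symm σ
      · exact (pointsEquiv p).permCongrHom.apply_symm_apply σ

theorem conjBy_threeCycle_affineA :
    conjBy ((threeCycle (0 : ZMod p), 1) : _ × affineSubgroup p H)
      (affineDiagonal p H (affineA p H)) = (threeCycle 1, 1) := by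
  rw [conjBy_threeCycle]
  congr 2
  rw [Perm.inv_eq_iff_eq]
  simp [affineA]

theorem conjBy_threeCycle_affineA_zpow (n : ℤ) :
    conjBy ((threeCycle (0 : ZMod p), 1) : _ × affineSubgroup p H)
      (affineDiagonal p H (affineA p H) ^ n) = (threeCycle (n : ZMod p), 1) := by
  rw [← map_zpow, conjBy_threeCycle]
  congr 2
  rw [Perm.inv_eq_iff_eq, affineA_zpow_apply, sub_self]

/-- Here `(p + 1) / 2 = κ + 1`, so `h = 1` puts `b` itself in `N`. The 3-cycles in `h` sit at `1`
and the nonsquare `-1`, in different cosets of the squares. -/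
theorem nonempty_presJ_equiv_alternatingGroup (hp : p % 12 = 11)
    (hrs : IsParam p (unitSquares p) r s) :
    Nonempty ((presJ p ((p - 1) / 2) s (hAlt p ((p - 1) / 2))).toGroup ≃*
      alternatingGroup (Fin (p + 2))) := by
  have hp2 : p ≠ 2 := by omega
  have hq : (p + 1) / 2 = (p - 1) / 2 + 1 := by omega
  obtain ⟨⟨u, hur, huH⟩, hs⟩ := id hrs
  refine nonempty_presJ_equiv (isGoodSubgroup_unitSquares hp) hrs (m := 1) one_pos ?_ ?_ ?_ ?_ ?_
  · intro h
    have := IsParam.mul_eq hur hs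
    rw [pow_one, ← hur] at h
    rw [h, one_mul, eq_comm, sub_eq_self] at this
    exact one_ne_zero this
  · intro G _ a g h hκ N hN hz
    rw [lift_hAlt] at h
    have := Subgroup.pow_mem_of_mul_mul_pow_eq_one hN (Subgroup.conjBy_mem hN hz a)
      (Subgroup.conjBy_mem hN hz a⁻¹) h
    rw [hq, pow_succ, hκ, one_mul] at this
    rwa [pow_one]
  · intro v hv _ hvH g hg3 hgκ
    have h1 := conjBy_threeCycle_affineA_zpow (H := unitSquares p) (-1)
    rw [zpow_neg_one] at h1
    rw [lift_hAlt, hg3, hgκ, conjBy_threeCycle_affineA, h1, Prod.pow_fst]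
    have hzp : Subgroup.zpowers v⁻¹ = unitSquares p := by rw [Subgroup.zpowers_inv, hvH]
    have hord : orderOf v⁻¹ + 1 = (p + 1) / 2 := by
      rw [← Nat.card_zpowers, hzp, card_unitSquares hp2, hq]
    have h2 := dilation_mul_threeCycle_pow (v := v⁻¹) (j := -1) (by rw [hzp, index_unitSquares hp2])
      (by rw [hzp]; exact neg_one_notMem_unitSquares (by omega))
    rw [hord] at h2
    simpa [affineDiagonal, affineB] using h2
  · intro σ
    rw [mem_alternatingGroup]
    constructor
    · exact fun h => ⟨1, by simp [h]⟩
    · rintro ⟨t, ht⟩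
      rw [← ht]
      exact sign_eq_one_of_mem_AGL1Sq hp2 t.2
  · have := two_mul_nat_card_alternatingGroup (α := Fin (p + 2))
    rw [this, Nat.card_perm, Nat.card_fin, mul_one]

/-- Here `2 * ((p + 1) / 2) = κ + 2`, so `h = 1` only puts `b ^ 2` in `N`. The square of `b` is a
dilation generating the squares, and the 3-cycles sit at `1` and the nonsquare `r`. -/
theorem nonempty_presJ_equiv_perm (hp : p % 3 = 2) (hp2 : 2 < p) (hrs : IsParam p ⊤ r s) :
    Nonempty ((presJ p (p - 1) s (hSym p (p - 1) r)).toGroup ≃* Perm (Fin (p + 2))) := by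
  have hp2' : p ≠ 2 := by omega
  have hodd := (Fact.out : p.Prime).odd_of_ne_two hp2'
  have hq : 2 * ((p + 1) / 2) = p - 1 + 2 := by
    obtain ⟨k, hk⟩ := hodd
    omega
  obtain ⟨⟨u, hur, huH⟩, hs⟩ := id hrs
  have hcardsq : Nat.card (unitSquares p) = (p - 1) / 2 := card_unitSquares hp2'
  suffices h : Nonempty ((presJ p (p - 1) s (hSym p (p - 1) r)).toGroup ≃*
      (⊤ : Subgroup (Perm (Fin (p + 2))))) from h.map fun e => e.trans Subgroup.topEquiv
  refine nonempty_presJ_equiv (isGoodSubgroup_top hp) hrs (m := 2) two_pos ?_ ?_ ?_ ?_ ?_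
  · intro h
    -- Otherwise the squares would be trivial and `p = 3`, against `p % 3 = 2`.
    have hu2 : u ^ 2 = 1 := Units.ext (by rw [Units.val_pow_eq_pow_val, hur, h, Units.val_one])
    rw [← zpowers_sq_of_zpowers_eq_top huH, hu2, Subgroup.zpowers_one_eq_bot,
      Subgroup.card_bot] at hcardsq
    omega
  · intro G _ a g h hκ N hN hz
    rw [lift_hSym] at h
    have := Subgroup.pow_mem_of_mul_mul_pow_eq_one hN (Subgroup.conjBy_mem hN hz a)
      (Subgroup.conjBy_mem hN hz (a ^ r)) h
    rwa [← pow_mul, hq, pow_add, hκ, one_mul] at this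
  · intro v hv hvr hvH g hg3 hgκ
    rw [lift_hSym, hg3, hgκ, conjBy_threeCycle_affineA, conjBy_threeCycle_affineA_zpow,
      Prod.pow_fst, ← hvr]
    have hzp : Subgroup.zpowers (v⁻¹ ^ 2) = unitSquares p :=
      zpowers_sq_of_zpowers_eq_top (by rw [Subgroup.zpowers_inv, hvH])
    have hord : orderOf (v⁻¹ ^ 2) + 1 = (p + 1) / 2 := by
      rw [← Nat.card_zpowers, hzp, hcardsq]
      omega
    have h2 := dilation_mul_threeCycle_pow (v := v⁻¹ ^ 2) (j := v)
      (by rw [hzp, index_unitSquares hp2'])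
      (by rw [hzp]; exact notMem_unitSquares_of_zpowers_eq_top hp2' hvH)
    rw [hord, map_pow, map_pow] at h2
    exact h2
  · intro σ
    refine ⟨fun _ => ?_, fun _ => Subgroup.mem_top σ⟩
    rcases Int.units_eq_one_or (sign σ) with h | h
    · exact ⟨1, by simp [h]⟩
    -- Odd permutations are reached because a generating dilation is odd.
    · exact ⟨⟨dilation p u, dilation_mem_affineSubgroup (Subgroup.mem_top u)⟩,
        (sign_dilation_of_zpowers_eq_top hp2' huH).trans h.symm⟩
  · rw [Nat.card_congr Subgroup.topEquiv.toEquiv, Nat.card_perm, Nat.card_fin, mul_comm]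

end Isomorphisms

theorem mainTheorem4 :
    ∃ C : ℝ, ∀ (p : ℕ) [Fact p.Prime],
      -- the alternating case
      (p % 12 = 11 →
        ((evenSubgroup p (AGL1Sq p)).index = 2 ∧
          (∀ H : Subgroup (Equiv.Perm (Fin (p + 2)) × AGL1Sq p), H.index = 2 →
            H.map (disjointAction p (AGL1Sq p)) ≤ alternatingGroup (Fin (p + 2) ⊕ ZMod p) →
            H = evenSubgroup p (AGL1Sq p)) ∧
          evenSubgroup p (AGL1Sq p) = (alternatingGroup (Fin (p + 2))).prod ⊤) ∧
        (∃ r s : ℤ, (0 ≤ r ∧ r < p) ∧ (0 ≤ s ∧ s < p) ∧ IsParam p (unitSquares p) r s) ∧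
        ∀ r s : ℤ, IsParam p (unitSquares p) r s →
          Nonempty ((presJ p ((p - 1) / 2) s (hAlt p ((p - 1) / 2))).toGroup ≃*
            alternatingGroup (Fin (p + 2))) ∧
          Nonempty ((presJHat p ((p - 1) / 2) s).toGroup ≃*
            alternatingGroup (Fin (p + 2)) × AGL1Sq p) ∧
          Nonempty ((presJHat p ((p - 1) / 2) s).toGroup ≃* evenSubgroup p (AGL1Sq p)) ∧
          (|r| ≤ p → |s| ≤ p →
            ((presJ p ((p - 1) / 2) s (hAlt p ((p - 1) / 2))).bitLength : ℝ)
              ≤ C * Real.log p ∧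
            ((presJHat p ((p - 1) / 2) s).bitLength : ℝ) ≤ C * Real.log p)) ∧
      -- the symmetric case
      (p % 3 = 2 → 2 < p →
        ((evenSubgroup p (AGL1 p)).index = 2 ∧
          (∀ H : Subgroup (Equiv.Perm (Fin (p + 2)) × AGL1 p), H.index = 2 →
            H.map (disjointAction p (AGL1 p)) ≤ alternatingGroup (Fin (p + 2) ⊕ ZMod p) →
            H = evenSubgroup p (AGL1 p))) ∧
        (∃ r s : ℤ, (0 ≤ r ∧ r < p) ∧ (0 ≤ s ∧ s < p) ∧ IsParam p ⊤ r s) ∧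
        ∀ r s : ℤ, IsParam p ⊤ r s →
          Nonempty ((presJ p (p - 1) s (hSym p (p - 1) r)).toGroup ≃*
            Equiv.Perm (Fin (p + 2))) ∧
          Nonempty ((presJHat p (p - 1) s).toGroup ≃* evenSubgroup p (AGL1 p)) ∧
          (|r| ≤ p → |s| ≤ p →
            ((presJ p (p - 1) s (hSym p (p - 1) r)).bitLength : ℝ) ≤ C * Real.log p ∧
            ((presJHat p (p - 1) s).bitLength : ℝ) ≤ C * Real.log p)) := by

  refine ⟨500, fun p _ => ⟨fun hp => ?_, fun hp hp2 => ?_⟩⟩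
  · have hp2 : p ≠ 2 := by omega
    have hgood := isGoodSubgroup_unitSquares hp
    have heven := evenSubgroup_AGL1Sq hp2
    refine ⟨⟨index_evenSubgroup, fun H hH hle => eq_evenSubgroup_of_index_two hH hle, heven⟩,
      exists_isParam (by rw [hgood.card]; omega), fun r s hrs => ?_⟩
    have hJHat := nonempty_presJHat_equiv hgood hrs
    refine ⟨nonempty_presJ_equiv_alternatingGroup hp hrs, ?_, hJHat, fun _ hs => ⟨?_, ?_⟩⟩
    · exact hJHat.map fun e => e.trans ((MulEquiv.subgroupCongr heven).trans
        ((Subgroup.prodEquiv _ _).trans (MulEquiv.prodCongr (MulEquiv.refl _) Subgroup.topEquiv)))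
    · exact bitLength_presJ_le (by omega) (by omega) hs
        (wordBitLength_hAlt_le (by omega) (by omega))
    · exact bitLength_presJHat_le (by omega) (by omega) hs
  · have hgood := isGoodSubgroup_top hp
    refine ⟨⟨index_evenSubgroup, fun H hH hle => eq_evenSubgroup_of_index_two hH hle⟩,
      exists_isParam (by rw [hgood.card]; omega), fun r s hrs => ?_⟩
    refine ⟨nonempty_presJ_equiv_perm hp hp2 hrs, nonempty_presJHat_equiv hgood hrs,
      fun hr hs => ⟨?_, ?_⟩⟩
    · exact bitLength_presJ_le (by omega) (by omega) hs
        (wordBitLength_hSym_le (by omega) (by omega) hr)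
    · exact bitLength_presJHat_le (by omega) (by omega) hs
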